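/- Let $\mathcal C$ be a finite nonempty set of candidates and $\mathcal V$ a finite nonempty set of voters. A vote is a linear order on $\mathcal C$, and a profile $P$ assigns a vote to each voter. For candidates $a\neq b$ let $D_P(a,b)$ be the number of voters who prefer $a$ to $b$ minus the number of voters who prefer $b$ to $a$. The maximin score of $a$ is $\min_{b\ne a}D_P(a,b)$ (with $\min\emptyset=+\infty$). The maximin rule $r$ selects, among the candidates of maximum maximin score, the one ranked highest by a given tie-breaking linear order $\succ_t$ on $\mathcal C$. Let $x=r(P)$ be the current winner. A set $M\subseteq\mathcal V$ is a coalition of possible manipulators against a candidate $y$ if $y\ne x$ and there are votes $(\succ'_j)_{j\in M}$ with $x\succ'_j y$ for all $j\in M$ such that $y$ wins under $r$ in the profile obtained from $P$ by replacing the vote of each $j\in M$ by $\succ'_j$. The set $M$ is a coalition of possible manipulators if it is one against some candidate. Consider the following decision problems, in which the input always contains $\mathcal C$, $\mathcal V$, the profile $P$ and the tie-breaking order $\succ_t$: - CPMW: given also $M\subseteq\mathcal V$ and $y\in\mathcal C$, is $M$ a coalition of possible manipulators against $y$? - CPM: given also $M\subseteq\mathcal V$, is $M$ a coalition of possible manipulators?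 - CPMSW: given also $y\in\mathcal C$ and a number $k$, is there $M\subseteq\mathcal V$ with $|M|\le k$ that is a coalition of possible manipulators against $y$? - CPMS: given also a number $k$, is there $M\subseteq\mathcal V$ with $|M|\le k$ that is a coalition of possible manipulators? **Theorem.** For the maximin voting rule, the problems CPMW and CPM restricted to instances with $|M|=1$, and the problems CPMSW and CPMS restricted to instances with $k=1$, are in $\mathsf P$. That is, for each of these four problems, the set of binary encodings of its yes-instances is decided by a Turing machine in time polynomial in the length of the input string. -/

import Mathlib

namespace PossibleManipulators

/-! ### Votes, profiles, voting rules -/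

/-- A linear order on the candidate set `Fin m`, given as the ranking that lists the candidates
from best to worst: `v p` is the candidate at position `p`, and position `0` is the top. -/
abbrev Vote (m : ℕ) : Type := Equiv.Perm (Fin m)

/-- `a` is strictly preferred to `b` in the vote `v`. -/
def Vote.Prefers {m : ℕ} (v : Vote m) (a b : Fin m) : Prop := v.symm a < v.symm b

instance {m : ℕ} (v : Vote m) (a b : Fin m) : Decidable (v.Prefers a b) :=
  inferInstanceAs (Decidable (v.symm a < v.symm b))

/-- A preference profile: one vote for each of the `n` voters. -/
abbrev Profile (m n : ℕ) : Type := Fin n → Vote m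

/-- A voting correspondence assigns to every profile (with at least one candidate and at least one
voter) a nonempty set of winning candidates. -/
abbrev VotingCorrespondence : Type :=
  ∀ (m n : ℕ) [NeZero m] [NeZero n], Profile m n → {S : Finset (Fin m) // S.Nonempty}

/-- Lexicographic tie breaking: the member of `S` that the tie-breaking order `t` ranks highest. -/
def tieBreak {m : ℕ} (t : Vote m) (S : {S : Finset (Fin m) // S.Nonempty}) : Fin m :=
  t ((S.1.image t.symm).min' (S.2.image t.symm))

/-- The voting rule obtained from a voting correspondence and a lexicographic tie-breaking order. -/
def winner (F : VotingCorrespondence) {m n : ℕ} [NeZero m] [NeZero n] (t : Vote m)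
    (P : Profile m n) : Fin m :=
  tieBreak t (F m n P)

/-! ### The maximin voting correspondence -/

/-- The number of voters who prefer `a` to `b`. -/
def numPrefer {m n : ℕ} (P : Profile m n) (a b : Fin m) : ℕ :=
  (Finset.univ.filter fun i => (P i).Prefers a b).card

/-- The weight of the edge `(a, b)` in the weighted majority graph. -/
def margin {m n : ℕ} (P : Profile m n) (a b : Fin m) : ℤ :=
  (numPrefer P a b : ℤ) - (numPrefer P b a : ℤ)

/-- The maximin score of `a`: the minimum of `margin P a b` over all `b ≠ a`
(`⊤` when `a` is the only candidate). -/
def maximinScore {m n : ℕ} (P : Profile m n) (a : Fin m) : WithTop ℤ :=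
  (Finset.univ.erase a).inf fun b => ((margin P a b : ℤ) : WithTop ℤ)

/-- The candidates with maximum maximin score. -/
def maximinWinners {m n : ℕ} (P : Profile m n) : Finset (Fin m) :=
  Finset.univ.filter fun a => ∀ b, maximinScore P b ≤ maximinScore P a

theorem maximinWinners_nonempty {m n : ℕ} [NeZero m] (P : Profile m n) :
    (maximinWinners P).Nonempty := by
  obtain ⟨a, -, ha⟩ := Finset.exists_max_image (Finset.univ : Finset (Fin m)) (maximinScore P)
    ⟨0, Finset.mem_univ _⟩
  exact ⟨a, Finset.mem_filter.2 ⟨Finset.mem_univ _, fun b => ha b (Finset.mem_univ _)⟩⟩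

def maximin : VotingCorrespondence :=
  fun _ _ _ _ P => ⟨maximinWinners P, maximinWinners_nonempty P⟩

/-! ### Coalitions of possible manipulators -/

/-- The profile in which the voters in `M` vote according to `Q` and all others according to `P`. -/
def replaceVotes {m n : ℕ} (P : Profile m n) (M : Finset (Fin n)) (Q : M → Vote m) :
    Profile m n :=
  fun i => if h : i ∈ M then Q ⟨i, h⟩ else P i

/-- `M` is a coalition of possible manipulators against `y` with respect to the voting rule `r`. -/
def IsCoalitionAgainst {m n : ℕ} (r : Profile m n → Fin m) (P : Profile m n)
    (M : Finset (Fin n)) (y : Fin m) : Prop :=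
  y ≠ r P ∧ ∃ Q : M → Vote m,
    (∀ j, (Q j).Prefers (r P) y) ∧ r (replaceVotes P M Q) = y

/-- `M` is a coalition of possible manipulators with respect to the voting rule `r`. -/
def IsCoalition {m n : ℕ} (r : Profile m n → Fin m) (P : Profile m n)
    (M : Finset (Fin n)) : Prop :=
  ∃ y, IsCoalitionAgainst r P M y

/-! ### Decision problems and the class P -/

/-- A decision problem: a type of instances, an injective encoding of the instances by binary
strings, and the set of yes-instances. -/
structure DecisionProblem where
  Inst : Type
  encode : Inst → List Bool
  encode_injective : Function.Injective encode
  Yes : Inst → Prop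

/-- The language of the encodings of the yes-instances. -/
def DecisionProblem.language (p : DecisionProblem) : Language Bool :=
  {w | ∃ I : p.Inst, p.Yes I ∧ p.encode I = w}

/-- The restriction of a decision problem to the instances that satisfy `c`. -/
def DecisionProblem.restrict (p : DecisionProblem) (c : p.Inst → Prop) : DecisionProblem where
  Inst := {I : p.Inst // c I}
  encode I := p.encode I.1
  encode_injective := p.encode_injective.comp Subtype.val_injective
  Yes I := p.Yes I.1

open Classical in
/-- The class P: some Turing machine decides, for every binary string, whether it belongs to the
language, in time polynomial in the length of the string. -/
def LanguageInP (L : Language Bool) : Prop :=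
  Nonempty (Turing.TM2ComputableInPolyTime (id : List Bool → List Bool) Computability.encodeBool
    (fun w => decide (w ∈ L)))

def DecisionProblem.InP (p : DecisionProblem) : Prop := LanguageInP p.language

/-! ### Encoding of elections

A natural number `j` is written as `j` ones followed by a zero. For candidates and voters this
unary notation makes no difference to polynomial time: every instance lists, for each of its voters,
all of its candidates, so its length is at least the number of voters and of candidates in any
reasonable encoding. The bound `k` is used only with the fixed value `1`. -/

def encodeNats (l : List ℕ) : List Bool :=
  l.flatMap fun j => List.replicate j true ++ [false]

theorem encodeNats_injective : Function.Injective encodeNats := by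
  have key : ∀ (a b : ℕ) (s t : List Bool),
      List.replicate a true ++ false :: s = List.replicate b true ++ false :: t →
        a = b ∧ s = t := by
    intro a
    induction a with
    | zero =>
      intro b s t h
      cases b with
      | zero => simpa using h
      | succ b => simp [List.replicate_succ] at h
    | succ a ih =>
      intro b s t h
      cases b with
      | zero => simp [List.replicate_succ] at h
      | succ b =>
        obtain ⟨h1, h2⟩ := ih b s t (by simpa [List.replicate_succ] using h)
        exact ⟨by omega, h2⟩
  intro l
  induction l with
  | nil =>
    intro l' h
    cases l' with
    | nil => rfl
    | cons b t => simp [encodeNats] at h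
  | cons a s ih =>
    intro l' h
    cases l' with
    | nil => simp [encodeNats] at h
    | cons b t =>
      obtain ⟨h1, h2⟩ := key a b (encodeNats s) (encodeNats t) (by simpa [encodeNats] using h)
      rw [h1, ih h2]

/-- The candidates, from best to worst. -/
def Vote.code {m : ℕ} (v : Vote m) : List ℕ := List.ofFn fun p => (v p : ℕ)

theorem Vote.code_injective {m : ℕ} : Function.Injective (Vote.code : Vote m → List ℕ) := by
  intro v w h
  have h1 := List.ofFn_injective h
  exact Equiv.ext fun p => Fin.ext (congrFun h1 p)

/-- An election: `m ≥ 1` candidates, `n ≥ 1` voters, their votes, and the order that the voting rule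
uses for breaking ties. -/
structure Election where
  m : ℕ
  n : ℕ
  [m_ne_zero : NeZero m]
  [n_ne_zero : NeZero n]
  tie : Vote m
  votes : Profile m n

attribute [instance] Election.m_ne_zero Election.n_ne_zero

/-- The numbers of candidates and voters, then the tie-breaking order, then all votes. -/
def Election.code (E : Election) : List ℕ :=
  [E.m, E.n] ++ E.tie.code ++ (List.ofFn fun i => (E.votes i).code).flatten

theorem Election.code_append_inj {E E' : Election} {s s' : List ℕ}
    (h : E.code ++ s = E'.code ++ s') : E = E' ∧ s = s' := by
  obtain ⟨m, n, t, P⟩ := E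
  obtain ⟨m', n', t', P'⟩ := E'
  simp only [Election.code, List.cons_append, List.nil_append, List.cons.injEq,
    List.append_assoc] at h
  obtain ⟨rfl, rfl, h⟩ := h
  obtain ⟨h1, h2⟩ := List.append_inj h (by simp [Vote.code])
  obtain rfl := Vote.code_injective h1
  have hl : ∀ Q : Profile m n, (List.ofFn fun i => (Q i).code).flatten.length = n * m := by
    intro Q
    simp [List.length_flatten, List.map_ofFn, Function.comp_def, Vote.code]
  obtain ⟨h3, h4⟩ := List.append_inj h2 (by rw [hl, hl])
  have h5 : (List.ofFn fun i => (P i).code) = List.ofFn fun i => (P' i).code := by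
    apply List.eq_iff_flatten_eq.2
    refine ⟨h3, ?_⟩
    simp [List.map_ofFn, Function.comp_def, Vote.code]
  have h6 := List.ofFn_injective h5
  obtain rfl : P = P' := funext fun i => Vote.code_injective (congrFun h6 i)
  exact ⟨rfl, h4⟩

/-- The winner of the election. -/
def Election.winner (F : VotingCorrespondence) (E : Election) (P : Profile E.m E.n) : Fin E.m :=
  PossibleManipulators.winner F E.tie P

/-- A set of voters as its indicator vector. -/
def coalitionCode {n : ℕ} (M : Finset (Fin n)) : List ℕ :=
  List.ofFn fun i => if i ∈ M then 1 else 0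

theorem coalitionCode_injective {n : ℕ} :
    Function.Injective (coalitionCode : Finset (Fin n) → List ℕ) := by
  intro M M' h
  have h1 := List.ofFn_injective h
  ext i
  have h2 := congrFun h1 i
  by_cases a : i ∈ M <;> by_cases b : i ∈ M' <;> simp_all

/-! ### The four problems -/

structure CPMWInstance extends Election where
  M : Finset (Fin n)
  y : Fin m

structure CPMInstance extends Election where
  M : Finset (Fin n)

structure CPMSWInstance extends Election where
  y : Fin m
  k : ℕ

structure CPMSInstance extends Election where
  k : ℕ

/-- Coalitional Possible Manipulators given Winner. -/
def CPMW (F : VotingCorrespondence) : DecisionProblem where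
  Inst := CPMWInstance
  encode I := encodeNats (I.code ++ (coalitionCode I.M ++ [(I.y : ℕ)]))
  encode_injective := by
    intro I J h
    obtain ⟨h1, h2⟩ := Election.code_append_inj (encodeNats_injective h)
    obtain ⟨E, M, y⟩ := I
    obtain ⟨E', M', y'⟩ := J
    obtain rfl : E = E' := h1
    obtain ⟨h3, h4⟩ := List.append_inj h2 (by simp [coalitionCode])
    obtain rfl : M = M' := coalitionCode_injective h3
    obtain rfl : y = y' := Fin.ext (by simpa using h4)
    rfl
  Yes I := IsCoalitionAgainst (I.winner F) I.votes I.M I.y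

/-- Coalitional Possible Manipulators. -/
def CPM (F : VotingCorrespondence) : DecisionProblem where
  Inst := CPMInstance
  encode I := encodeNats (I.code ++ coalitionCode I.M)
  encode_injective := by
    intro I J h
    obtain ⟨h1, h2⟩ := Election.code_append_inj (encodeNats_injective h)
    obtain ⟨E, M⟩ := I
    obtain ⟨E', M'⟩ := J
    obtain rfl : E = E' := h1
    obtain rfl : M = M' := coalitionCode_injective h2
    rfl
  Yes I := IsCoalition (I.winner F) I.votes I.M

/-- Coalitional Possible Manipulators Search given Winner. -/
def CPMSW (F : VotingCorrespondence) : DecisionProblem where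
  Inst := CPMSWInstance
  encode I := encodeNats (I.code ++ [(I.y : ℕ), I.k])
  encode_injective := by
    intro I J h
    obtain ⟨h1, h2⟩ := Election.code_append_inj (encodeNats_injective h)
    obtain ⟨E, y, k⟩ := I
    obtain ⟨E', y', k'⟩ := J
    obtain rfl : E = E' := h1
    simp only [List.cons.injEq, and_true] at h2
    obtain rfl : y = y' := Fin.ext h2.1
    obtain rfl : k = k' := h2.2
    rfl
  Yes I := ∃ M : Finset (Fin I.n), M.card ≤ I.k ∧
    IsCoalitionAgainst (I.winner F) I.votes M I.y

/-- Coalitional Possible Manipulators Search. -/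
def CPMS (F : VotingCorrespondence) : DecisionProblem where
  Inst := CPMSInstance
  encode I := encodeNats (I.code ++ [I.k])
  encode_injective := by
    intro I J h
    obtain ⟨h1, h2⟩ := Election.code_append_inj (encodeNats_injective h)
    obtain ⟨E, k⟩ := I
    obtain ⟨E', k'⟩ := J
    obtain rfl : E = E' := h1
    obtain rfl : k = k' := by simpa using h2
    rfl
  Yes I := ∃ M : Finset (Fin I.n), M.card ≤ I.k ∧ IsCoalition (I.winner F) I.votes M

end PossibleManipulators

/-!
Fix the manipulator `j`, the candidate `y` who shall win instead of the winner `x`, and the number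
`s` of voters who shall at least prefer `y` to each opponent. Every other candidate `a` must then
lose: some candidate `b` must be preferred to `a` by the voters other than `j` rarely enough, given
whether `b` is above `a` in the new vote of `j`. Whether `a` may come directly below the set `T` of
candidates in this vote, and whether `y` may (which requires `x ∈ T`), depends on `T` only
monotonically. Hence a vote can be built greedily from the top, and it exists if and only if
iterating a monotone operator on sets of candidates from `∅` reaches all of them. There are only
polynomially many choices of `j`, `y` and `s`.

The Turing machines come from structured programs on stacks of bits, whose only loop empties a
stack. The functions that such programs compute in polynomial time are closed under composition and
under iteration with intermediate values of polynomially bounded size.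
-/

namespace PossibleManipulators

open Function (update update_apply)

/-! ### Structured programs on stacks -/

/-- Structured programs over stacks of bits indexed by `K`. The only control structure is `drain k`:
as long as the stack `k` is nonempty, pop a bit `b` and run `body b`. -/
inductive Prog (K : Type) : Type
  | nop : Prog K
  | push (k : K) (b : Bool) : Prog K
  | seq (p q : Prog K) : Prog K
  | drain (k : K) (body : Bool → Prog K) : Prog K

section Runs

open scoped Classical in
/-- `Runs p S t S'`: started on the stacks `S`, the program `p` terminates within `t` steps on the
stacks `S'`. -/
inductive Runs {K : Type} : Prog K → (K → List Bool) → ℕ → (K → List Bool) → Prop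
  | nop (S) : Runs .nop S 1 S
  | push {k b} {S S' : K → List Bool} : update S k (b :: S k) = S' → Runs (.push k b) S 1 S'
  | seq {p q S t S' t' S''} : Runs p S t S' → Runs q S' t' S'' → Runs (.seq p q) S (t + t') S''
  | drain_nil {k body S} : S k = [] → Runs (.drain k body) S 1 S
  | drain_cons {k body S b l t S' t' S''} : S k = b :: l → Runs (body b) (update S k l) t S' →
      Runs (.drain k body) S' t' S'' → Runs (.drain k body) S (1 + t + t') S''
  | mono {p S t t' S'} : Runs p S t S' → t ≤ t' → Runs p S t' S'

variable {K K' : Type}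

open scoped Classical in
theorem Runs.length_le {p : Prog K} {S S' : K → List Bool} {t : ℕ} (h : Runs p S t S') (k : K) :
    (S' k).length ≤ (S k).length + t := by
  induction h with
  | nop | drain_nil => omega
  | @push k' _ _ _ hS =>
    obtain rfl | hk := eq_or_ne k k'
    · simp only [← hS, Function.update_self, List.length_cons]; omega
    · simp [← hS, hk]
  | seq _ _ ih₁ ih₂ => omega
  | @drain_cons k' _ S _ l _ _ _ _ hS _ _ ih₁ ih₂ =>
    have : (update S k' l k).length ≤ (S k).length := by
      obtain rfl | hk := eq_or_ne k k'
      · simp [hS]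
      · simp [hk]
    omega
  | mono _ ht ih => omega

/-- Rename the stacks of a program. -/
def Prog.map (e : K → K') : Prog K → Prog K'
  | .nop => .nop
  | .push k b => .push (e k) b
  | .seq p q => .seq (p.map e) (q.map e)
  | .drain k body => .drain (e k) fun b => (body b).map e

open scoped Classical in
theorem update_extend {e : K → K'} (he : e.Injective) (S : K → List Bool) (R : K' → List Bool)
    (k : K) (l : List Bool) :
    update (e.extend S R) (e k) l = e.extend (update S k l) R := by
  funext k'
  by_cases hk' : ∃ k, e k = k'
  · obtain ⟨k, rfl⟩ := hk'
    simp only [he.extend_apply, Function.update_apply, he.eq_iff]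
  · rw [Function.extend_apply' _ _ _ hk', Function.update_of_ne, Function.extend_apply' _ _ _ hk']
    rintro rfl
    exact hk' ⟨k, rfl⟩

theorem Runs.map_extend {e : K → K'} (he : e.Injective) {p : Prog K} {S S' : K → List Bool} {t : ℕ}
    (h : Runs p S t S') (R : K' → List Bool) :
    Runs (p.map e) (e.extend S R) t (e.extend S' R) := by
  induction h with
  | nop => exact .nop _
  | push hS => exact .push (by rw [he.extend_apply, update_extend he, hS])
  | seq _ _ ih₁ ih₂ => exact ih₁.seq ih₂
  | drain_nil hS => exact .drain_nil (by rwa [he.extend_apply])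
  | drain_cons hS _ _ ih₁ ih₂ =>
    exact .drain_cons (by rwa [he.extend_apply]) (by rwa [update_extend he]) ih₂
  | mono _ ht ih => exact ih.mono ht

theorem Runs.map {p : Prog K} {S S' : K → List Bool} {t : ℕ} (h : Runs p S t S') {e : K → K'}
    {R R' : K' → List Bool} (he : e.Injective := by simp +zetaDelta [Function.Injective])
    (hR : R ∘ e = S := by first | rfl | simp +zetaDelta [funext_iff])
    (hR' : R' ∘ e = S' := by first | rfl | simp +zetaDelta [funext_iff])
    (hframe : ∀ k ∉ Set.range e, R' k = R k := by simp +zetaDelta) : Runs (p.map e) R t R' := by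
  have extend_eq {Q : K' → List Bool} (hQ : ∀ k ∉ Set.range e, Q k = R k) :
      e.extend (Q ∘ e) R = Q := by
    funext k
    by_cases hk : k ∈ Set.range e
    · obtain ⟨k, rfl⟩ := hk
      exact he.extend_apply _ _ _
    · rw [Function.extend_apply' _ _ _ hk, hQ k hk]
  have := h.map_extend he R
  rwa [← hR, ← hR', extend_eq fun _ _ => rfl, extend_eq hframe] at this

open scoped Classical in
/-- The states `S l₁ l₂` are indexed by the part `l₁` of the stack that has already been consumed
and the part `l₂` that is left. -/
theorem Runs.drain {k : K} {body : Bool → Prog K} {t : ℕ}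
    (S : List Bool → List Bool → K → List Bool) (L : List Bool)
    (hS : ∀ l₁ l₂ l, update (S l₁ l₂) k l = S l₁ l)
    (h : ∀ l₁ b l₂, L = l₁ ++ b :: l₂ → Runs (body b) (S l₁ l₂) t (S (l₁ ++ [b]) l₂)) :
    Runs (.drain k body) (S [] L) (L.length * (1 + t) + 1) (S L []) := by
  have apply_k : ∀ l₁ l₂, S l₁ l₂ k = l₂ := fun l₁ l₂ => by
    rw [← hS l₁ l₂ l₂, Function.update_self]
  suffices ∀ l₂ l₁, L = l₁ ++ l₂ →
      Runs (.drain k body) (S l₁ l₂) (l₂.length * (1 + t) + 1) (S L []) from this L [] rfl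
  intro l₂
  induction l₂ with
  | nil =>
    rintro l₁ rfl
    simpa using Runs.drain_nil (apply_k l₁ [])
  | cons b l₂ ih =>
    intro l₁ hL
    refine (Runs.drain_cons (apply_k ..) ?_ (ih (l₁ ++ [b]) (by simp [hL]))).mono
      (by rw [List.length_cons]; linarith)
    rw [hS]
    exact h l₁ b l₂ hL

/-- Run `p i` for every `i`, in some order. -/
noncomputable def Prog.forEach {ι : Type} [Fintype ι] (p : ι → Prog K) : Prog K :=
  (Finset.univ.toList.map p).foldr .seq .nop

open scoped Classical in
/-- The states `S s` are indexed by the set `s` of those `i` that have already been treated. -/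
theorem Runs.forEach {ι : Type} [Fintype ι] {p : ι → Prog K} {t : ι → ℕ}
    (S : Finset ι → K → List Bool)
    (h : ∀ s, ∀ i ∉ s, Runs (p i) (S s) (t i) (S (insert i s))) :
    Runs (.forEach p) (S ∅) (∑ i, t i + 1) (S Finset.univ) := by
  suffices ∀ l : List ι, l.Nodup → ∀ s, (∀ i ∈ l, i ∉ s) →
      Runs ((l.map p).foldr .seq .nop) (S s) ((l.map t).sum + 1) (S (s ∪ l.toFinset)) by
    simpa [Prog.forEach, Finset.toList_toFinset] using
      this Finset.univ.toList (Finset.nodup_toList _) ∅ (by simp)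
  intro l
  induction l with
  | nil => exact fun _ s _ => by simpa using Runs.nop (S s)
  | cons i l ih =>
    intro hl s hs
    obtain ⟨hi, hl⟩ := List.nodup_cons.1 hl
    have hrest : ∀ j ∈ l, j ∉ insert i s := fun j hj =>
      Finset.mem_insert.not.2
        (not_or.2 ⟨ne_of_mem_of_not_mem hj hi, hs j (List.mem_cons_of_mem _ hj)⟩)
    have := (h s i (hs i List.mem_cons_self)).seq (ih hl _ hrest)
    rw [Finset.insert_union, ← Finset.union_insert, ← List.toFinset_cons] at this
    simpa only [List.map_cons, List.sum_cons, List.foldr_cons, add_assoc] using this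

/-- Empty all stacks. -/
noncomputable def Prog.clear [Fintype K] : Prog K :=
  .forEach fun k => .drain k fun _ => .nop

open scoped Classical in
theorem Runs.clear [Fintype K] (S : K → List Bool) :
    Runs .clear S (2 * ∑ k, (S k).length + Fintype.card K + 1) fun _ => [] := by
  have drain_nop (S : K → List Bool) (k : K) :
      Runs (.drain k fun _ => .nop) S ((S k).length * (1 + 1) + 1) (update S k []) := by
    simpa using Runs.drain (fun _ l => update S k l) (S k) (by simp) fun _ _ _ _ => .nop _
  have := Runs.forEach (t := fun k => (S k).length * (1 + 1) + 1)
    (fun s k => if k ∈ s then [] else S k) fun s k hk => by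
      convert drain_nop (fun k => if k ∈ s then [] else S k) k using 1
      · simp [hk]
      · ext1 k'
        obtain rfl | hk' := eq_or_ne k' k <;> simp [*]
  simpa [Prog.clear, Finset.sum_add_distrib, ← Finset.sum_mul, mul_comm 2] using this

end Runs

/-! ### Compilation to Turing machines -/

section Compilation

open Turing StateTransition

variable {K Λ : Type}

/-- The labels of the Turing machine that executes a program. -/
def Prog.Label : Prog K → Type
  | .nop | .push _ _ => Unit
  | .seq p q => p.Label ⊕ q.Label
  | .drain _ body => Option (Σ b, (body b).Label)

theorem Prog.finite_label : ∀ p : Prog K, Finite p.Label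
  | .nop | .push _ _ => inferInstanceAs (Finite Unit)
  | .seq p q =>
    have := p.finite_label
    have := q.finite_label
    inferInstanceAs (Finite (p.Label ⊕ q.Label))
  | .drain _ body =>
    have := fun b => (body b).finite_label
    inferInstanceAs (Finite (Option (Σ b, (body b).Label)))

/-- The label at which the execution of a program starts. -/
def Prog.entry : (p : Prog K) → p.Label
  | .nop | .push _ _ => ()
  | .seq p _ => .inl p.entry
  | .drain _ _ => none

/-- The statements of the Turing machine for a program that is part of a bigger machine: `emb`
embeds its labels, and `exit` is the label to jump to after the execution. The local variable of the
machine holds the bit popped last; it is reset to `none` outside of a step of `drain`. -/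
def Prog.stmt : (p : Prog K) → (p.Label → Λ) → Λ → p.Label →
    TM2.Stmt (fun _ : K => Bool) Λ (Option Bool)
  | .nop, _, exit, _ => .goto fun _ => exit
  | .push k b, _, exit, _ => .push k (fun _ => b) (.goto fun _ => exit)
  | .seq p q, emb, _, .inl l => p.stmt (emb ∘ .inl) (emb (.inr q.entry)) l
  | .seq _ q, emb, exit, .inr l => q.stmt (emb ∘ .inr) exit l
  | .drain k body, emb, exit, none =>
    .pop k (fun _ top => top) (.branch Option.isNone (.goto fun _ => exit)
      (.branch (· == some true)
        (.load (fun _ => none) (.goto fun _ => emb (some ⟨true, (body true).entry⟩)))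
        (.load (fun _ => none) (.goto fun _ => emb (some ⟨false, (body false).entry⟩)))))
  | .drain _ body, emb, _, some ⟨b, l⟩ => (body b).stmt (fun l => emb (some ⟨b, l⟩)) (emb none) l

theorem evalsToInTime_of_eq_some {C : Type} {f : C → Option C} {c c' : C} (h : f c = some c') :
    Nonempty (EvalsToInTime f c (some c') 1) :=
  ⟨⟨1, h⟩, le_rfl⟩

open scoped Classical in
theorem Runs.evalsToInTime {M : Λ → TM2.Stmt (fun _ : K => Bool) Λ (Option Bool)} {p : Prog K}
    {S S' : K → List Bool} {t : ℕ} (h : Runs p S t S') (emb : p.Label → Λ) (exit : Λ)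
    (hM : ∀ l, M (emb l) = p.stmt emb exit l) :
    Nonempty (EvalsToInTime (TM2.step M) ⟨some (emb p.entry), none, S⟩
      (some ⟨some exit, none, S'⟩) t) := by
  induction h generalizing exit with
  | nop =>
    refine evalsToInTime_of_eq_some ?_
    rw [TM2.step, hM]
    rfl
  | push hS =>
    refine evalsToInTime_of_eq_some ?_
    rw [TM2.step, hM, ← hS]
    rfl
  | @seq p q _ _ _ _ _ _ _ ih₁ ih₂ =>
    obtain ⟨e₁⟩ := ih₁ (emb ∘ .inl) (emb (.inr q.entry)) fun l => hM (.inl l)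
    obtain ⟨e₂⟩ := ih₂ (emb ∘ .inr) exit fun l => hM (.inr l)
    rw [add_comm]
    exact ⟨.trans _ _ _ _ _ _ e₁ e₂⟩
  | @drain_nil k body S hS =>
    have : update S k [] = S := by rw [← hS, Function.update_eq_self]
    refine evalsToInTime_of_eq_some ?_
    rw [TM2.step, hM]
    simp [Prog.entry, Prog.stmt, hS, this]
  | @drain_cons k body S b l t S' t' S'' hS _ _ ih₁ ih₂ =>
    obtain ⟨e₁⟩ := ih₁ (fun l => emb (some ⟨b, l⟩)) (emb none) fun l => hM (some ⟨b, l⟩)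
    obtain ⟨e₂⟩ := ih₂ emb exit hM
    obtain ⟨e₀⟩ : Nonempty (EvalsToInTime (TM2.step M)
        ⟨some (emb (Prog.drain k body).entry), none, S⟩
        (some ⟨some (emb (some ⟨b, (body b).entry⟩)), none, update S k l⟩) 1) := by
      refine evalsToInTime_of_eq_some ?_
      rw [TM2.step, hM]
      cases b <;> simp [Prog.entry, Prog.stmt, hS]
    rw [add_comm, add_comm 1]
    exact ⟨.trans _ _ _ _ _ _ (.trans _ _ _ _ _ _ e₀ e₁) e₂⟩
  | mono _ ht ih =>
    obtain ⟨e⟩ := ih emb exit hM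
    exact ⟨⟨e.toEvalsTo, e.steps_le_m.trans ht⟩⟩

/-- The machine that executes `p` and then halts at the label `none`. -/
noncomputable def Prog.machine [Finite K] (p : Prog K) (input output : K) : FinTM2 where
  K := K
  kDecidableEq := Classical.decEq K
  kFin := Fintype.ofFinite K
  k₀ := input
  k₁ := output
  Γ _ := Bool
  Λ := Option p.Label
  main := some p.entry
  ΛFin := have := p.finite_label; Fintype.ofFinite _
  σ := Option Bool
  initialState := none
  m l := l.elim .halt (p.stmt some none)

open scoped Classical in
theorem Runs.outputsInTime [Finite K] {p : Prog K} {input output : K} {w v : List Bool} {t : ℕ}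
    (h : Runs p (update (fun _ => []) input w) t (update (fun _ => []) output v)) :
    Nonempty (TM2OutputsInTime (p.machine input output) w (some v) (t + 1)) := by
  have stk_eq (k₀ : K) (l : List Bool) : (fun k => if _ : k = k₀ then l else []) =
      update (fun _ => []) k₀ l :=
    funext fun k => (Function.update_apply (fun _ => []) k₀ l k).symm
  have init_eq : initList (p.machine input output) w =
      ⟨some (some p.entry), none, update (fun _ => []) input w⟩ :=
    congrArg (TM2.Cfg.mk _ _) (stk_eq input w)
  have halt_eq : haltList (p.machine input output) v =
      ⟨none, none, update (fun _ => []) output v⟩ :=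
    congrArg (TM2.Cfg.mk _ _) (stk_eq output v)
  have ⟨run⟩ := h.evalsToInTime (M := (p.machine input output).m) some none fun _ => rfl
  have ⟨halt⟩ := evalsToInTime_of_eq_some (f := (p.machine input output).step)
    (c := ⟨some none, none, update (fun _ => []) output v⟩) rfl
  refine ⟨?_⟩
  change EvalsToInTime _ _ (some (haltList (p.machine input output) v)) _
  rw [add_comm, init_eq, halt_eq]
  exact .trans _ _ _ _ _ _ run halt

open scoped Classical in
theorem tm2ComputableInPolyTime_of_runs [Finite K] {f : List Bool → Bool} (p : Prog K)
    (input output : K) (q : Polynomial ℕ)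
    (h : ∀ w, Runs p (update (fun _ => []) input w) (q.eval w.length)
      (update (fun _ => []) output [f w])) :
    Nonempty (TM2ComputableInPolyTime (id : List Bool → List Bool) Computability.encodeBool f) := by
  refine ⟨⟨⟨p.machine input output, .refl Bool, .refl Bool⟩, q + 1, fun w => Classical.choice ?_⟩⟩
  have outputs : ∀ w' v', w' = w → v' = [f w] → Nonempty
      (TM2OutputsInTime (p.machine input output) w' (some v') ((q + 1).eval w.length)) := by
    rintro _ _ rfl rfl
    simpa using (h _).outputsInTime
  exact outputs _ _ (List.map_id w) (List.map_id [f w])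

end Compilation

/-! ### Functions computable in polynomial time -/

/-- Types whose elements are encoded by the contents of finitely many stacks, their registers. -/
class StackEncodable (α : Type) where
  Reg : Type
  [fintypeReg : Fintype Reg]
  enc : α → Reg → List Bool

attribute [reducible, instance] StackEncodable.fintypeReg

open StackEncodable (Reg enc)

namespace StackEncodable

instance : StackEncodable (List Bool) := ⟨Unit, fun l _ => l⟩

/-- Natural numbers are encoded in unary. -/
instance : StackEncodable ℕ := ⟨Unit, fun n _ => List.replicate n true⟩

instance : StackEncodable (List ℕ) := ⟨Unit, fun l _ => encodeNats l⟩

open scoped Classical in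
/-- With this encoding the decidable predicates are functions into `Prop`. -/
noncomputable instance : StackEncodable Prop := ⟨Unit, fun P _ => [decide P]⟩

instance {α β : Type} [StackEncodable α] [StackEncodable β] : StackEncodable (α × β) :=
  ⟨Reg α ⊕ Reg β, fun x => Sum.elim (enc x.1) (enc x.2)⟩

/-- The total length of the encoding. -/
def size {α : Type} [StackEncodable α] (a : α) : ℕ := ∑ r, (enc a r).length

theorem length_enc_le {α : Type} [StackEncodable α] (a : α) (r : Reg α) :
    (enc a r).length ≤ size a :=
  Finset.single_le_sum (f := fun r => (enc a r).length) (fun _ _ => zero_le) (Finset.mem_univ r)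

theorem size_prod {α β : Type} [StackEncodable α] [StackEncodable β] (x : α × β) :
    size x = size x.1 + size x.2 :=
  Fintype.sum_sum_type _

@[simp] theorem size_nat (n : ℕ) : size n = n :=
  (Fintype.sum_unique (ι := Unit) _).trans List.length_replicate

@[simp] theorem size_prop (P : Prop) : size P = 1 :=
  Fintype.sum_unique (ι := Unit) _

@[simp] theorem size_list (l : List Bool) : size l = l.length :=
  Fintype.sum_unique (ι := Unit) _

end StackEncodable

open StackEncodable

theorem monotone_polynomial_eval (q : Polynomial ℕ) : Monotone fun n => q.eval n := by
  intro m n h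
  simp only [Polynomial.eval_eq_sum, Polynomial.sum]
  gcongr

/-- The quantity `t` is bounded by a polynomial in the size of its argument. -/
def PolyBounded {α : Type} [StackEncodable α] (t : α → ℕ) : Prop :=
  ∃ q : Polynomial ℕ, ∀ a, t a ≤ q.eval (size a)

/-- The function `f` is computed in polynomial time by a structured program, which finds the
argument in the first, writes the value to the second, and uses the third kind of stacks as its
workspace. -/
@[fun_prop]
def PolyTime {α β : Type} [StackEncodable α] [StackEncodable β] (f : α → β) : Prop :=
  ∃ (T : Type) (_ : Finite T) (p : Prog (Reg α ⊕ Reg β ⊕ T)) (time : α → ℕ), PolyBounded time ∧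
    ∀ a, Runs p (Sum.elim (enc a) fun _ => []) (time a)
      (Sum.elim (enc a) (Sum.elim (enc (f a)) fun _ => []))

section PolyTime

variable {α β γ σ : Type} [StackEncodable α] [StackEncodable β] [StackEncodable γ]
  [StackEncodable σ]

namespace PolyBounded

variable {s t : α → ℕ}

theorem mono (hs : PolyBounded s) (h : ∀ a, t a ≤ s a) : PolyBounded t :=
  have ⟨q, hq⟩ := hs
  ⟨q, fun a => (h a).trans (hq a)⟩

theorem const (c : ℕ) : PolyBounded fun _ : α => c :=
  ⟨.C c, fun _ => by rw [Polynomial.eval_C]⟩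

theorem size : PolyBounded (size : α → ℕ) :=
  ⟨.X, fun _ => by rw [Polynomial.eval_X]⟩

theorem add (hs : PolyBounded s) (ht : PolyBounded t) : PolyBounded fun a => s a + t a :=
  have ⟨q, hq⟩ := hs
  have ⟨r, hr⟩ := ht
  ⟨q + r, fun a => by rw [Polynomial.eval_add]; exact add_le_add (hq a) (hr a)⟩

theorem mul (hs : PolyBounded s) (ht : PolyBounded t) : PolyBounded fun a => s a * t a :=
  have ⟨q, hq⟩ := hs
  have ⟨r, hr⟩ := ht
  ⟨q * r, fun a => by rw [Polynomial.eval_mul]; exact Nat.mul_le_mul (hq a) (hr a)⟩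

theorem sum {ι : Type} (I : Finset ι) {t : ι → α → ℕ} (ht : ∀ i, PolyBounded (t i)) :
    PolyBounded fun a => ∑ i ∈ I, t i a := by
  choose q hq using ht
  exact ⟨∑ i ∈ I, q i, fun a => by
    rw [Polynomial.eval_finsetSum]; exact Finset.sum_le_sum fun i _ => hq i a⟩

theorem polynomial_eval (q : Polynomial ℕ) (hs : PolyBounded s) :
    PolyBounded fun a => q.eval (s a) :=
  have ⟨r, hr⟩ := hs
  ⟨q.comp r, fun a => by rw [Polynomial.eval_comp]; exact monotone_polynomial_eval q (hr a)⟩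

theorem comp {t : β → ℕ} (ht : PolyBounded t) {f : α → β}
    (hf : PolyBounded fun a => StackEncodable.size (f a)) : PolyBounded fun a => t (f a) :=
  have ⟨q, hq⟩ := ht
  (hf.polynomial_eval q).mono fun a => hq (f a)

end PolyBounded

namespace PolyTime

theorem size_le {f : α → β} (hf : PolyTime f) : PolyBounded fun a => size (f a) := by
  obtain ⟨T, _, p, time, htime, hp⟩ := hf
  refine (PolyBounded.sum Finset.univ fun _ : Reg β => htime).mono fun a =>
    Finset.sum_le_sum fun r _ => ?_
  simpa using (hp a).length_le (.inr (.inl r))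

open scoped Classical in
theorem copyReg (r : Reg α) : PolyTime fun a : α => enc a r := by
  refine ⟨Unit, inferInstance,
    .seq (.drain (.inl r) fun b => .push (.inr (.inr ())) b)
      (.drain (.inr (.inr ())) fun b => .seq (.push (.inl r) b) (.push (.inr (.inl ())) b)),
    fun a => 5 * size a + 2, ((PolyBounded.const 5).mul .size).add (.const 2), fun a => ?_⟩
  let M (l out tmp : List Bool) : Reg α ⊕ Unit ⊕ Unit → List Bool :=
    Sum.elim (fun r' => if r' = r then l else enc a r') (Sum.elim (fun _ => out) fun _ => tmp)
  have reverse := Runs.drain (k := .inl r) (body := fun b => .push (.inr (.inr ())) b)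
    (fun l₁ l₂ => M l₂ [] l₁.reverse) (enc a r)
    (fun _ _ _ => by ext1 (_ | _ | _) <;> simp +contextual [M, update_apply])
    fun l₁ b l₂ _ => .push (by ext1 (_ | _ | _) <;> simp [M])
  have restore := Runs.drain (k := .inr (.inr ()))
    (body := fun b => .seq (.push (.inl r) b) (.push (.inr (.inl ())) b))
    (fun l₁ l₂ => M l₁.reverse l₁.reverse l₂) (enc a r).reverse
    (fun _ _ _ => by ext1 (_ | _ | _) <;> simp [M])
    fun l₁ b l₂ _ => .seq (.push rfl)
      (.push (by ext1 (_ | _ | _) <;> simp +contextual [M, update_apply, -Sum.elim_update_left]))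
  have hM out : M (enc a r) out [] = Sum.elim (enc a) (Sum.elim (fun _ => out) fun _ => []) := by
    ext1 (_ | _ | _) <;> simp +contextual [M]
  have both := reverse.seq restore
  simp only [List.reverse_nil, List.reverse_reverse, List.length_reverse, hM,
    Sum.elim_lam_const_lam_const] at both
  have hlength := length_enc_le a r
  exact both.mono (by dsimp only; omega)

open scoped Classical in
theorem of_regs {f : α → β} (h : ∀ r, PolyTime fun a => enc (f a) r) : PolyTime f := by
  choose T _ p time htime hp using h
  have hp r a : Runs (K := Reg α ⊕ Unit ⊕ T r) (p r) (Sum.elim (enc a) fun _ => []) (time r a)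
      (Sum.elim (enc a) (Sum.elim (fun _ => enc (f a) r) fun _ => [])) := hp r a
  let e (r : Reg β) : Reg α ⊕ Unit ⊕ T r → Reg α ⊕ Reg β ⊕ (Σ r, T r) :=
    Sum.map id (Sum.map (fun _ => r) (Sigma.mk r))
  refine ⟨Σ r, T r, inferInstance, .forEach fun r => (p r).map (e r), _,
    (PolyBounded.sum Finset.univ htime).add (.const 1), fun a => ?_⟩
  let M (s : Finset (Reg β)) : Reg α ⊕ Reg β ⊕ (Σ r, T r) → List Bool :=
    Sum.elim (enc a) (Sum.elim (fun r => if r ∈ s then enc (f a) r else []) fun _ => [])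
  have := Runs.forEach (p := fun r => (p r).map (e r)) (t := fun r => time r a) M fun s r hr =>
      (hp r a).map (hR := by simp [e, M, funext_iff, hr])
        (hframe := by simp +contextual [e, M, eq_comm (a := r)])
  simpa [M] using this

@[fun_prop]
protected theorem id : PolyTime fun a : α => a := of_regs copyReg

@[fun_prop]
theorem comp {g : β → γ} {f : α → β} (hg : PolyTime g) (hf : PolyTime f) :
    PolyTime fun a => g (f a) := by
  have hsize := hf.size_le
  obtain ⟨T, _, p, s, hs, hp⟩ := hf
  obtain ⟨U, _, q, t, ht, hq⟩ := hg
  refine ⟨(Reg β ⊕ T) ⊕ U, inferInstance,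
    .seq (p.map (Sum.map id (.inr ∘ .inl)))
      (.seq (q.map (Sum.elim (.inr ∘ .inr ∘ .inl ∘ .inl) (.inr ∘ Sum.map id .inr)))
        (.map (.inr ∘ .inr ∘ .inl ∘ .inl) .clear)), _,
    hs.add ((ht.comp hsize).add
      ((((PolyBounded.const 2).mul hsize).add (.const (Fintype.card (Reg β)))).add (.const 1))),
    fun a => ?_⟩
  let M (b : Reg β → List Bool) (c : Reg γ → List Bool) :
      Reg α ⊕ Reg γ ⊕ (Reg β ⊕ T) ⊕ U → List Bool :=
    Sum.elim (enc a) (Sum.elim c (Sum.elim (Sum.elim b fun _ => []) fun _ => []))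
  exact .seq (S' := M (enc (f a)) fun _ => []) (hp a).map
    (.seq (S' := M (enc (f a)) (enc (g (f a)))) (hq (f a)).map (Runs.clear _).map)

@[fun_prop]
theorem fst : PolyTime (Prod.fst : α × β → α) := of_regs fun r => copyReg (α := α × β) (Sum.inl r)

@[fun_prop]
theorem snd : PolyTime (Prod.snd : α × β → β) := of_regs fun r => copyReg (α := α × β) (Sum.inr r)

@[fun_prop]
theorem prodMk {f : α → β} {g : α → γ} (hf : PolyTime f) (hg : PolyTime g) :
    PolyTime fun a => (f a, g a) :=
  of_regs <| Sum.rec (fun r => (copyReg r).comp hf) fun r => (copyReg r).comp hg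

theorem nil : PolyTime fun _ : α => ([] : List Bool) :=
  ⟨Empty, inferInstance, .nop, _, .const 1, fun a => by
    convert Runs.nop (Sum.elim (enc a) fun _ => []) using 1
    ext1 (_ | _ | _) <;> rfl⟩

theorem cons (b : Bool) {f : α → List Bool} (hf : PolyTime f) : PolyTime fun a => b :: f a := by
  obtain ⟨T, hT, p, time, htime, hp⟩ := hf
  refine ⟨T, hT, .seq p (.push (.inr (.inl ())) b), _, htime.add (.const 1),
    fun a => (hp a).seq (.push ?_)⟩
  ext1 (_ | r | _)
  · simp
  · cases r
    simp [enc]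
  · simp

@[fun_prop]
theorem const (b : β) : PolyTime fun _ : α => b := by
  have list (l : List Bool) : PolyTime fun _ : α => l := l.rec nil fun b _ => cons b
  exact of_regs fun r => list (enc b r)

theorem exists_inPlace {f : σ → σ} (hf : PolyTime f) :
    ∃ (T : Type) (_ : Finite T) (p : Prog (Reg σ ⊕ T)) (time : σ → ℕ), PolyBounded time ∧
      ∀ a, Runs p (Sum.elim (enc a) fun _ => []) (time a) (Sum.elim (enc (f a)) fun _ => []) := by
  have hsize := hf.size_le
  obtain ⟨T, _, p, s, hs, hp⟩ := hf
  obtain ⟨U, _, q, t, ht, hq⟩ := PolyTime.id (α := σ)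
  refine ⟨(Reg σ ⊕ T) ⊕ U, inferInstance,
    .seq (p.map (Sum.map id .inl)) (.seq (.map .inl .clear)
      (.seq (q.map (Sum.elim (.inr ∘ .inl ∘ .inl) (Sum.map id .inr)))
        (.map (.inr ∘ .inl ∘ .inl) .clear))), _,
    hs.add (((((PolyBounded.const 2).mul .size).add (.const (Fintype.card (Reg σ)))).add
      (.const 1)).add ((ht.comp hsize).add
      ((((PolyBounded.const 2).mul hsize).add (.const (Fintype.card (Reg σ)))).add (.const 1)))),
    fun a => ?_⟩
  let M (x y : Reg σ → List Bool) : Reg σ ⊕ (Reg σ ⊕ T) ⊕ U → List Bool :=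
    Sum.elim x (Sum.elim (Sum.elim y fun _ => []) fun _ => [])
  exact .seq (S' := M (enc a) (enc (f a))) (hp a).map
    (.seq (S' := M (fun _ => []) (enc (f a))) (Runs.clear _).map
      (.seq (S' := M (enc (f a)) (enc (f a))) (hq (f a)).map (Runs.clear _).map))

theorem exists_loop {step : σ → Bool → σ} (hstep : ∀ b, PolyTime fun s => step s b) :
    ∃ (V : Type) (_ : Finite V) (p : Prog (Unit ⊕ Reg σ ⊕ V)) (q : Polynomial ℕ),
      ∀ L s B, (∀ l, l <+: L → size (l.foldl step s) ≤ B) →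
        Runs p (Sum.elim (fun _ => L) (Sum.elim (enc s) fun _ => []))
          (L.length * (1 + q.eval B) + 1)
          (Sum.elim (fun _ => []) (Sum.elim (enc (L.foldl step s)) fun _ => [])) := by
  choose V _ p t ht hp using fun b => (hstep b).exists_inPlace
  choose q hq using ht
  let body b : Prog (Unit ⊕ Reg σ ⊕ Σ b, V b) :=
    (p b).map (Sum.elim (.inr ∘ .inl) (.inr ∘ .inr ∘ Sigma.mk b))
  refine ⟨Σ b, V b, inferInstance, .drain (.inl ()) body, ∑ b, q b, fun L s B hB => ?_⟩
  have step_time (l₁ : List Bool) b l₂ (hl : L = l₁ ++ b :: l₂) :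
      t b (l₁.foldl step s) ≤ (∑ b, q b).eval B :=
    calc t b (l₁.foldl step s) ≤ (q b).eval (size (l₁.foldl step s)) := hq b _
      _ ≤ (q b).eval B := monotone_polynomial_eval _ (hB l₁ ⟨b :: l₂, hl.symm⟩)
      _ ≤ (∑ b, q b).eval B := by
        rw [Polynomial.eval_finsetSum]
        exact Finset.single_le_sum (f := fun b => (q b).eval B) (fun _ _ => zero_le)
          (Finset.mem_univ b)
  let M (l₁ l₂ : List Bool) : Unit ⊕ Reg σ ⊕ (Σ b, V b) → List Bool :=
    Sum.elim (fun _ => l₂) (Sum.elim (enc (l₁.foldl step s)) fun _ => [])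
  exact Runs.drain M L (fun _ _ _ => by ext1 (_ | _ | _) <;> simp [M])
    fun l₁ b l₂ hl => ((hp b (l₁.foldl step s)).map
      (hR' := by simp [M, funext_iff])).mono (step_time l₁ b l₂ hl)

theorem foldl_of_step {L : α → List Bool} {init : α → σ} {step : σ → Bool → σ} {bound : α → ℕ}
    (hL : PolyTime L) (hinit : PolyTime init) (hstep : ∀ b, PolyTime fun s => step s b)
    (hbound : PolyBounded bound)
    (h : ∀ a l, l <+: L a → size (l.foldl step (init a)) ≤ bound a) :
    PolyTime fun a => (L a).foldl step (init a) := by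
  have hlength : PolyBounded fun a => (L a).length :=
    hL.size_le.mono fun a => length_enc_le (L a) ()
  obtain ⟨T, _, p, s, hs, hp⟩ := hL
  obtain ⟨U, _, q, t, ht, hq⟩ := hinit
  obtain ⟨V, _, r, w, hr⟩ := exists_loop hstep
  have hp a : Runs (K := Reg α ⊕ Unit ⊕ T) p (Sum.elim (enc a) fun _ => []) (s a)
      (Sum.elim (enc a) (Sum.elim (fun _ => L a) fun _ => [])) := hp a
  refine ⟨(Unit ⊕ T) ⊕ U ⊕ V, inferInstance,
    .seq (p.map (Sum.map id (.inr ∘ .inl)))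
      (.seq (q.map (Sum.map id (Sum.map id (.inr ∘ .inl))))
        (r.map (Sum.elim (.inr ∘ .inr ∘ .inl ∘ .inl) (.inr ∘ Sum.map id (.inr ∘ .inr))))), _,
    hs.add (ht.add ((hlength.mul ((PolyBounded.const 1).add (hbound.polynomial_eval w))).add
      (.const 1))), fun a => ?_⟩
  let M (x : Reg σ → List Bool) (l : List Bool) : Reg α ⊕ Reg σ ⊕ (Unit ⊕ T) ⊕ U ⊕ V → List Bool :=
    Sum.elim (enc a) (Sum.elim x (Sum.elim (Sum.elim (fun _ => l) fun _ => []) fun _ => []))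
  exact .seq (S' := M (fun _ => []) (L a)) (hp a).map
    (.seq (S' := M (enc (init a)) (L a)) (hq a).map (hr (L a) (init a) (bound a) (h a)).map)

/-- The sizes of the intermediate values have to be bounded: repeated squaring, say, is not
computable in polynomial time. -/
theorem foldl {L : α → List Bool} {init : α → σ} {step : α → σ → Bool → σ} {bound : α → ℕ}
    (hL : PolyTime L) (hinit : PolyTime init)
    (hstep : ∀ b, PolyTime fun x : α × σ => step x.1 x.2 b) (hbound : PolyBounded bound)
    (h : ∀ a l, l <+: L a → size (l.foldl (step a) (init a)) ≤ bound a) :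
    PolyTime fun a => (L a).foldl (step a) (init a) := by
  have foldl_prodMk a (l : List Bool) :
      l.foldl (fun (x : α × σ) b => (x.1, step x.1 x.2 b)) (a, init a) =
        (a, l.foldl (step a) (init a)) := by
    induction l using List.reverseRecOn with
    | nil => rfl
    | append_singleton l b ih => simp only [List.foldl_append, List.foldl_cons, List.foldl_nil, ih]
  have := snd.comp (foldl_of_step (step := fun (x : α × σ) b => (x.1, step x.1 x.2 b)) hL
    (PolyTime.id.prodMk hinit) (fun b => fst.prodMk (hstep b)) (PolyBounded.size.add hbound)
    fun a l hl => by
      rw [foldl_prodMk, StackEncodable.size_prod]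
      exact Nat.add_le_add_left (h a l hl) _)
  simpa only [foldl_prodMk] using this

end PolyTime
end PolyTime

section Arithmetic

variable {α σ : Type} [StackEncodable α] [StackEncodable σ]

namespace PolyTime

theorem iterate {n : α → ℕ} {init : α → σ} {f : α → σ → σ} {bound : α → ℕ} (hn : PolyTime n)
    (hinit : PolyTime init) (hf : PolyTime fun x : α × σ => f x.1 x.2) (hbound : PolyBounded bound)
    (h : ∀ a, ∀ k ≤ n a, size ((f a)^[k] (init a)) ≤ bound a) :
    PolyTime fun a => (f a)^[n a] (init a) := by
  have := foldl (step := fun a s _ => f a s) ((copyReg (α := ℕ) ()).comp hn) hinit (fun _ => hf)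
    hbound fun a l hl => by
      rw [List.foldl_const]
      exact h a _ (by simpa [enc] using hl.length_le)
  simpa only [List.foldl_const, enc, List.length_replicate] using this

theorem succ {f : α → ℕ} (hf : PolyTime f) : PolyTime fun a => f a + 1 :=
  of_regs fun _ => cons true ((copyReg (α := ℕ) ()).comp hf)

@[fun_prop]
theorem add {f g : α → ℕ} (hf : PolyTime f) (hg : PolyTime g) : PolyTime fun a => f a + g a := by
  have iterate_succ m k : (fun n => n + 1)^[k] m = m + k := by simp
  simpa only [iterate_succ] using iterate (f := fun _ n => n + 1) hg hf (succ snd)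
    (hf.size_le.add hg.size_le) fun a k hk => by simpa only [iterate_succ, size_nat] using by omega

theorem pred {f : α → ℕ} (hf : PolyTime f) : PolyTime fun a => f a - 1 := by
  have iterate_shift k : (fun x : ℕ × ℕ => (x.1 + 1, x.1))^[k] (0, 0) = (k, k - 1) := by
    induction k with
    | zero => rfl
    | succ k ih => rw [Function.iterate_succ_apply', ih, Nat.add_sub_cancel]
  have := iterate (init := fun _ => (0, 0)) (f := fun _ (x : ℕ × ℕ) => (x.1 + 1, x.1)) hf
    (by fun_prop) (by fun_prop) (hf.size_le.add hf.size_le) fun a k hk => by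
      simp only [iterate_shift, size_prod, size_nat]; omega
  simpa only [iterate_shift] using snd.comp this

@[fun_prop]
theorem sub {f g : α → ℕ} (hf : PolyTime f) (hg : PolyTime g) : PolyTime fun a => f a - g a := by
  have iterate_pred m k : (fun n => n - 1)^[k] m = m - k := Nat.pred_iterate m k
  simpa only [iterate_pred] using iterate (f := fun _ n => n - 1) hg hf (pred snd)
    hf.size_le fun a k _ => by simp [iterate_pred]

@[fun_prop]
theorem mul {f g : α → ℕ} (hf : PolyTime f) (hg : PolyTime g) : PolyTime fun a => f a * g a := by
  have iterate_add m k : (fun n => n + m)^[k] 0 = m * k := by simp [mul_comm]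
  simpa only [iterate_add] using iterate (init := fun _ => 0) (f := fun a n => n + f a) hg
    (const 0) (by fun_prop) (hf.size_le.mul hg.size_le) fun a k hk => by
      simpa only [iterate_add, size_nat] using Nat.mul_le_mul_left _ hk

@[fun_prop]
theorem ite {p : α → Prop} [DecidablePred p] {f g : α → σ} (hp : PolyTime p) (hf : PolyTime f)
    (hg : PolyTime g) : PolyTime fun a => if p a then f a else g a := by
  have := foldl (step := fun a s b => bif b then f a else s) ((copyReg (α := Prop) ()).comp hp) hg
    (fun b => by cases b <;> simp only [cond_true, cond_false] <;> fun_prop)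
    (hf.size_le.add hg.size_le) fun a l hl => by
      obtain rfl | rfl : l = [] ∨ l = enc (p a) () := by
        simpa [enc, List.prefix_cons_iff] using hl
      · simp
      · by_cases hpa : p a <;> simp [enc, hpa]
  simpa [enc, cond_eq_ite] using this

@[fun_prop]
theorem and {p q : α → Prop} (hp : PolyTime p) (hq : PolyTime q) : PolyTime fun a => p a ∧ q a := by
  classical
  simpa using hp.ite hq (const False)

@[fun_prop]
theorem not {p : α → Prop} (hp : PolyTime p) : PolyTime fun a => ¬p a := by
  classical
  simpa using hp.ite (const False) (const True)

@[fun_prop]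
theorem or {p q : α → Prop} (hp : PolyTime p) (hq : PolyTime q) : PolyTime fun a => p a ∨ q a := by
  simpa only [not_and_or, not_not] using (hp.not.and hq.not).not

theorem eq_zero {f : α → ℕ} (hf : PolyTime f) : PolyTime fun a => f a = 0 := by
  have iterate_false k : (fun _ => False)^[k] True ↔ k = 0 := by
    cases k <;> simp [Function.iterate_succ_apply']
  simpa only [iterate_false] using iterate (init := fun _ => True) (f := fun _ _ => False) hf
    (by fun_prop) (by fun_prop) (.const 1) (by simp)

@[fun_prop]
theorem le {f g : α → ℕ} (hf : PolyTime f) (hg : PolyTime g) : PolyTime fun a => f a ≤ g a := by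
  simpa only [Nat.sub_eq_zero_iff_le] using (hf.sub hg).eq_zero

@[fun_prop]
theorem lt {f g : α → ℕ} (hf : PolyTime f) (hg : PolyTime g) : PolyTime fun a => f a < g a :=
  hf.succ.le hg

@[fun_prop]
theorem eq {f g : α → ℕ} (hf : PolyTime f) (hg : PolyTime g) : PolyTime fun a => f a = g a := by
  simpa only [Nat.le_antisymm_iff] using (hf.le hg).and (hg.le hf)

@[fun_prop]
theorem exists_lt {n : α → ℕ} {p : α → ℕ → Prop} (hn : PolyTime n)
    (hp : PolyTime fun x : α × ℕ => p x.1 x.2) : PolyTime fun a => ∃ i < n a, p a i := by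
  have iterate_or a k : (fun s : ℕ × Prop => (s.1 + 1, s.2 ∨ p a s.1))^[k] (0, False) =
      (k, ∃ i < k, p a i) := by
    induction k with
    | zero => simp
    | succ k ih => simp only [Function.iterate_succ_apply', ih, Nat.exists_lt_succ_right]
  have := iterate (init := fun _ => (0, False))
    (f := fun a (s : ℕ × Prop) => (s.1 + 1, s.2 ∨ p a s.1)) hn (by fun_prop)
    (by fun_prop) (hn.size_le.add (.const 1)) fun a k hk => by
      simp only [iterate_or, size_prod, size_nat, size_prop]; omega
  simpa only [iterate_or] using snd.comp this

@[fun_prop]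
theorem forall_lt {n : α → ℕ} {p : α → ℕ → Prop} (hn : PolyTime n)
    (hp : PolyTime fun x : α × ℕ => p x.1 x.2) : PolyTime fun a => ∀ i < n a, p a i := by
  simpa only [not_exists, not_and, not_not] using
    (exists_lt (p := fun a i => ¬p a i) hn hp.not).not

@[fun_prop]
theorem count {n : α → ℕ} {p : α → ℕ → Prop} [∀ a, DecidablePred (p a)] (hn : PolyTime n)
    (hp : PolyTime fun x : α × ℕ => p x.1 x.2) : PolyTime fun a => Nat.count (p a) (n a) := by
  have iterate_add a k :
      (fun s : ℕ × ℕ => (s.1 + 1, s.2 + if p a s.1 then 1 else 0))^[k] (0, 0) =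
        (k, Nat.count (p a) k) := by
    induction k with
    | zero => simp
    | succ k ih => simp only [Function.iterate_succ_apply', ih, Nat.count_succ]
  have := iterate (init := fun _ => (0, 0))
    (f := fun a (s : ℕ × ℕ) => (s.1 + 1, s.2 + if p a s.1 then 1 else 0)) hn (by fun_prop)
    (by fun_prop) (hn.size_le.add hn.size_le) fun a k hk => by
      have := Nat.count_le (p := p a) (n := k)
      simp only [iterate_add, size_prod, size_nat]; omega
  simpa only [iterate_add] using snd.comp this

theorem reverse {l : α → List Bool} (hl : PolyTime l) : PolyTime fun a => (l a).reverse := by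
  simpa using foldl (init := fun _ => []) (step := fun _ s b => b :: s) hl (const [])
    (fun b => cons b snd) hl.size_le fun a l' hl' => by simpa using hl'.length_le

theorem table {n : α → ℕ} {p : α → ℕ → Prop} [∀ a, DecidablePred (p a)] (hn : PolyTime n)
    (hp : PolyTime fun x : α × ℕ => p x.1 x.2) :
    PolyTime fun a => (List.range (n a)).map fun i => decide (p a i) := by
  have iterate_cons a k :
      (fun s : ℕ × List Bool => (s.1 + 1, decide (p a s.1) :: s.2))^[k] (0, []) =
        (k, ((List.range k).map fun i => decide (p a i)).reverse) := by
    induction k with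
    | zero => simp
    | succ k ih => simp [Function.iterate_succ_apply', ih, List.range_succ]
  have hcons : PolyTime fun x : α × ℕ × List Bool => decide (p x.1 x.2.1) :: x.2.2 := by
    have := ite (p := fun x : α × ℕ × List Bool => p x.1 x.2.1) (by fun_prop)
      (cons true (snd.comp snd)) (cons false (snd.comp snd))
    convert this using 2
    split <;> simp [*]
  have := iterate (init := fun _ => (0, []))
    (f := fun a (s : ℕ × List Bool) => (s.1 + 1, decide (p a s.1) :: s.2)) hn (by fun_prop)
    (by fun_prop) (hn.size_le.add hn.size_le) fun a k hk => by
      simp only [iterate_cons, size_prod, size_nat, size_list, List.length_reverse,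
        List.length_map, List.length_range]
      omega
  simpa only [iterate_cons, List.reverse_reverse] using (snd.comp this).reverse

@[fun_prop]
theorem getD_eq_true {l : α → List Bool} {i : α → ℕ} (hl : PolyTime l) (hi : PolyTime i) :
    PolyTime fun a => (l a).getD (i a) false = true := by
  have foldl_or i (l : List Bool) :
      l.foldl (fun (s : ℕ × Prop) (b : Bool) => (s.1 + 1, s.2 ∨ b ∧ s.1 = i)) (0, False) =
        (l.length, l.getD i false = true) := by
    induction l using List.reverseRecOn with
    | nil => simp
    | append_singleton l b ih =>
      rw [List.foldl_append, ih]
      simp only [List.foldl_cons, List.foldl_nil, List.length_append, List.length_singleton,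
        Prod.mk.injEq, true_and, eq_iff_iff]
      grind
  have := foldl (init := fun _ => (0, False))
    (step := fun a (s : ℕ × Prop) (b : Bool) => (s.1 + 1, s.2 ∨ b ∧ s.1 = i a)) hl (const _)
    (fun b => by fun_prop) (hl.size_le.add (.const 1)) fun a l' hl' => by
      have := hl'.length_le
      simp only [foldl_or, size_prod, size_nat, size_prop, size_list]; omega
  simpa only [foldl_or] using snd.comp this

/-- The step of the automaton that reads `encodeNats l` and computes `(l.length, l.getD i 0)`: it
counts the zeros, which terminate the entries, and the ones in the entry with index `i`. -/
def entryStep (i : ℕ) (s : ℕ × ℕ) (b : Bool) : ℕ × ℕ :=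
  if b then (s.1, if s.1 = i then s.2 + 1 else s.2) else (s.1 + 1, s.2)

theorem foldl_entryStep_replicate (i k v x : ℕ) :
    (List.replicate x true).foldl (entryStep i) (k, v) = (k, if k = i then v + x else v) := by
  induction x with
  | zero => simp
  | succ x ih => rw [List.replicate_succ', List.foldl_append, ih]; grind [entryStep]

theorem foldl_entryStep_encodeNats (i : ℕ) (l : List ℕ) :
    (encodeNats l).foldl (entryStep i) (0, 0) = (l.length, l.getD i 0) := by
  induction l using List.reverseRecOn with
  | nil => rfl
  | append_singleton l x ih =>
    simp only [encodeNats, List.flatMap_append, List.flatMap_cons, List.flatMap_nil,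
      List.append_nil, List.foldl_append] at ih ⊢
    rw [ih, foldl_entryStep_replicate, List.foldl_cons, List.foldl_nil]
    grind [entryStep]

theorem size_foldl_entryStep_le (i : ℕ) (l : List Bool) :
    size (l.foldl (entryStep i) (0, 0)) ≤ l.length := by
  induction l using List.reverseRecOn with
  | nil => rfl
  | append_singleton l b ih =>
    simp only [size_prod, size_nat, List.foldl_append, List.foldl_cons, List.foldl_nil,
      List.length_append, List.length_singleton] at ih ⊢
    grind [entryStep]

theorem length_getD {l : α → List ℕ} {i : α → ℕ} (hl : PolyTime l) (hi : PolyTime i) :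
    PolyTime fun a => ((l a).length, (l a).getD (i a) 0) := by
  have := foldl (init := fun _ => (0, 0)) (step := fun a => entryStep (i a))
    ((copyReg (α := List ℕ) ()).comp hl) (const _)
    (fun b => by cases b <;> simp only [entryStep] <;> fun_prop) hl.size_le fun a l' hl' =>
      (size_foldl_entryStep_le _ l').trans (hl'.length_le.trans (length_enc_le (l a) ()))
  simpa only [enc, foldl_entryStep_encodeNats] using this

@[fun_prop]
theorem length {l : α → List ℕ} (hl : PolyTime l) : PolyTime fun a => (l a).length :=
  fst.comp (length_getD hl (const 0))

@[fun_prop]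
theorem getD {l : α → List ℕ} {i : α → ℕ} (hl : PolyTime l) (hi : PolyTime i) :
    PolyTime fun a => (l a).getD (i a) 0 :=
  snd.comp (length_getD hl hi)

end PolyTime

end Arithmetic

theorem languageInP_of_polyTime {L : Language Bool} (h : PolyTime fun w => w ∈ L) :
    LanguageInP L := by
  obtain ⟨T, _, p, time, ⟨q, hq⟩, hp⟩ := h
  refine tm2ComputableInPolyTime_of_runs (K := Unit ⊕ Unit ⊕ T)
    (.seq p (.drain (.inl ()) fun _ => .nop)) (.inl ()) (.inr (.inl ())) (q + (2 * .X + 1))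
    fun w => ?_
  classical
  let M (w out : List Bool) : Unit ⊕ Unit ⊕ T → List Bool :=
    Sum.elim (fun _ => w) (Sum.elim (fun _ => out) fun _ => [])
  have hin (_ : DecidableEq (Unit ⊕ Unit ⊕ T)) : update (fun _ => []) (.inl ()) w = M w [] := by
    ext1 (_ | _ | _) <;> simp [M]
  have hout (_ : DecidableEq (Unit ⊕ Unit ⊕ T)) (b : Bool) :
      update (fun _ => []) (.inr (.inl ())) [b] = M [] [b] := by
    ext1 (_ | _ | _) <;> simp [M]
  have compute : Runs p (M w []) (time w) (M w [decide (w ∈ L)]) := by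
    have hpw : Runs (K := Unit ⊕ Unit ⊕ T) p (Sum.elim (fun _ => w) fun _ => []) (time w)
        (Sum.elim (fun _ => w) (Sum.elim (fun _ => [decide (w ∈ L)]) fun _ => [])) := hp w
    simpa [M] using hpw
  have erase := Runs.drain (k := .inl ()) (body := fun _ => .nop)
    (fun _ l => M l [decide (w ∈ L)]) w (fun _ _ _ => by ext1 (_ | _ | _) <;> simp [M])
    fun _ _ _ _ => .nop _
  have htime := hq w
  rw [size_list] at htime
  rw [hin, hout]
  refine (compute.seq erase).mono ?_
  simp only [Polynomial.eval_add, Polynomial.eval_mul, Polynomial.eval_ofNat, Polynomial.eval_X,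
    Polynomial.eval_one]
  omega

theorem mem_range_encodeNats {w : List Bool} :
    w ∈ Set.range encodeNats ↔ w.foldl (fun _ b => b = false) True := by
  have append_false (w : List Bool) : ∃ l, encodeNats l = w ++ [false] := by
    induction w with
    | nil => exact ⟨[0], rfl⟩
    | cons b w ih =>
      obtain ⟨l, hl⟩ := ih
      cases b
      · exact ⟨0 :: l, by simp [encodeNats, ← hl]⟩
      · cases l with
        | nil => simp [encodeNats] at hl
        | cons x l =>
          exact ⟨(x + 1) :: l, by simp [← hl, encodeNats, List.replicate_succ]⟩
  cases w using List.reverseRecOn with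
  | nil => exact iff_of_true ⟨[], rfl⟩ trivial
  | append_singleton w b =>
    simp only [List.foldl_append, List.foldl_cons, List.foldl_nil]
    refine ⟨fun ⟨l, hl⟩ => ?_, fun hb => hb ▸ append_false w⟩
    cases l using List.reverseRecOn with
    | nil => simp [encodeNats] at hl
    | append_singleton l x =>
      simpa [encodeNats, eq_comm] using congrArg List.getLast? hl

theorem languageInP_encodeNats {Q : List ℕ → Prop} (hQ : PolyTime Q) :
    LanguageInP {w | ∃ l, Q l ∧ encodeNats l = w} := by
  classical
  let decode := Function.invFun encodeNats
  have decode_encodeNats l : decode (encodeNats l) = l :=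
    Function.leftInverse_invFun encodeNats_injective l
  have range : PolyTime fun w => w ∈ Set.range encodeNats := by
    simp only [mem_range_encodeNats]
    exact .foldl (init := fun _ => True) (step := fun _ _ b => b = false) .id (.const _)
      (fun _ => .const _) (.const 1) (by simp)
  have decode_polyTime : PolyTime decode := by
    refine .of_regs fun _ => ?_
    convert range.ite .id (.const (encodeNats (Classical.arbitrary (List ℕ)))) with w
    split_ifs with hw
    · exact Function.invFun_eq hw
    · exact congrArg encodeNats (Function.invFun_neg hw)
  apply languageInP_of_polyTime
  convert range.and (hQ.comp decode_polyTime) using 2 with w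
  refine ⟨?_, ?_⟩
  · rintro ⟨l, hl, rfl⟩
    exact ⟨⟨l, rfl⟩, by rwa [decode_encodeNats]⟩
  · rintro ⟨⟨l, rfl⟩, hl⟩
    exact ⟨l, by rwa [decode_encodeNats] at hl, rfl⟩

/-! ### Maximin winners -/

theorem Vote.prefers_or_prefers {m : ℕ} (v : Vote m) {a b : Fin m} (h : a ≠ b) :
    v.Prefers a b ∨ v.Prefers b a :=
  lt_or_gt_of_ne (v.symm.injective.ne h)

theorem Vote.Prefers.not_prefers {m : ℕ} {v : Vote m} {a b : Fin m} (h : v.Prefers a b) :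
    ¬v.Prefers b a :=
  lt_asymm h

theorem tieBreak_eq_iff {m : ℕ} {t : Vote m} {S : {S : Finset (Fin m) // S.Nonempty}} {x : Fin m} :
    tieBreak t S = x ↔ x ∈ S.1 ∧ ∀ b ∈ S.1, t.symm x ≤ t.symm b := by
  have isLeast := Finset.isLeast_min' _ (S.2.image t.symm)
  have isLeast_iff : IsLeast (S.1.image t.symm : Set (Fin m)) (t.symm x) ↔
      x ∈ S.1 ∧ ∀ b ∈ S.1, t.symm x ≤ t.symm b := by
    simp only [IsLeast, mem_lowerBounds, Finset.coe_image, Set.forall_mem_image,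
      t.symm.injective.mem_set_image, Finset.mem_coe]
  rw [tieBreak, ← Equiv.eq_symm_apply, ← isLeast_iff]
  exact ⟨fun h => h ▸ isLeast, isLeast.unique⟩

section Maximin

variable {m n : ℕ} {P : Profile m n} {a b y : Fin m} {s : ℕ}

theorem numPrefer_add_numPrefer (P : Profile m n) (h : a ≠ b) :
    numPrefer P a b + numPrefer P b a = n := by
  have prefers_swap : ∀ i, (P i).Prefers b a ↔ ¬(P i).Prefers a b := fun i =>
    ⟨Vote.Prefers.not_prefers, ((P i).prefers_or_prefers h).resolve_left⟩
  simp only [numPrefer, prefers_swap, Finset.card_filter_add_card_filter_not, Finset.card_univ,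
    Fintype.card_fin]

theorem margin_eq (P : Profile m n) (h : a ≠ b) : margin P a b = 2 * numPrefer P a b - n := by
  have := numPrefer_add_numPrefer P h
  rw [margin]
  omega

theorem le_maximinScore_iff :
    ((2 * s - n : ℤ) : WithTop ℤ) ≤ maximinScore P a ↔ ∀ d ≠ a, s ≤ numPrefer P a d := by
  simp only [maximinScore, Finset.le_inf_iff, Finset.mem_erase, Finset.mem_univ, and_true,
    WithTop.coe_le_coe]
  refine forall₂_congr fun d hd => ?_
  rw [margin_eq P hd.symm]
  omega

theorem maximinScore_lt_iff :
    maximinScore P a < ((2 * s - n : ℤ) : WithTop ℤ) ↔ ∃ c ≠ a, numPrefer P a c < s := by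
  simpa using le_maximinScore_iff.not

theorem maximinScore_le_iff :
    maximinScore P a ≤ ((2 * s - n : ℤ) : WithTop ℤ) ↔ ∃ c ≠ a, numPrefer P a c ≤ s := by
  rw [maximinScore, Finset.inf_le_iff (by exact WithTop.coe_lt_top _)]
  simp only [Finset.mem_erase, Finset.mem_univ, and_true, WithTop.coe_le_coe]
  refine exists_congr fun c => and_congr_right fun hc => ?_
  rw [margin_eq P hc.symm]
  omega

theorem exists_maximinScore_eq (P : Profile m n) (h : b ≠ a) :
    ∃ s ≤ n, maximinScore P a = ((2 * s - n : ℤ) : WithTop ℤ) := by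
  obtain ⟨c, hc, hmin⟩ := Finset.exists_min_image (Finset.univ.erase a) (numPrefer P a)
    ⟨b, by simpa using h⟩
  simp only [Finset.mem_erase, Finset.mem_univ, and_true] at hc hmin
  exact ⟨numPrefer P a c, (numPrefer_add_numPrefer P hc.symm).le.trans' (Nat.le_add_right _ _),
    le_antisymm (maximinScore_le_iff.2 ⟨c, hc, le_rfl⟩) (le_maximinScore_iff.2 hmin)⟩

theorem winner_maximin_eq_iff_maximinScore [NeZero m] [NeZero n] {t : Vote m} :
    winner maximin t P = y ↔ ∀ b ≠ y, maximinScore P b ≤ maximinScore P y ∧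
      (¬t.Prefers y b → maximinScore P b < maximinScore P y) := by
  simp only [winner, tieBreak_eq_iff, maximin, maximinWinners, Finset.mem_filter, Finset.mem_univ,
    true_and]
  constructor
  · rintro ⟨hmax, hle⟩ b hb
    refine ⟨hmax b, fun hyb => (hmax b).lt_of_ne fun heq => hyb ?_⟩
    exact (hle b fun c => heq ▸ hmax c).lt_of_ne (t.symm.injective.ne hb.symm)
  · intro h
    refine ⟨fun b => ?_, fun b hb => ?_⟩
    · obtain rfl | hby := eq_or_ne b y
      exacts [le_rfl, (h b hby).1]
    · obtain rfl | hby := eq_or_ne b y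
      · exact le_rfl
      · by_contra hlt
        exact ((h b hby).2 fun hyb => hlt hyb.le).not_ge (hb y)

/-- The threshold `s` separates the counts that make up the score of `y` from those that the
scores of the other candidates may attain. -/
theorem winner_maximin_eq_iff [NeZero m] [NeZero n] {t : Vote m} :
    winner maximin t P = y ↔ ∃ s ≤ n, ∀ b ≠ y, s ≤ numPrefer P y b ∧
      ∃ c ≠ b, numPrefer P b c < s + if t.Prefers y b then 1 else 0 := by
  have loses_iff s b : (∃ c ≠ b, numPrefer P b c < s + if t.Prefers y b then 1 else 0) ↔
      maximinScore P b ≤ ((2 * s - n : ℤ) : WithTop ℤ) ∧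
        (¬t.Prefers y b → maximinScore P b < ((2 * s - n : ℤ) : WithTop ℤ)) := by
    split_ifs with h
    · simp only [h, Nat.lt_succ_iff, maximinScore_le_iff, not_true, false_imp_iff, and_true]
    · simp only [h, ← maximinScore_lt_iff, add_zero, not_false_iff, true_imp_iff]
      exact ⟨fun h => ⟨h.le, h⟩, And.right⟩
  simp only [forall_and, loses_iff, ← le_maximinScore_iff]
  rw [winner_maximin_eq_iff_maximinScore]
  constructor
  · intro h
    by_cases hm : ∃ b, b ≠ y
    · obtain ⟨b, hb⟩ := hm
      obtain ⟨s, hs, heq⟩ := exists_maximinScore_eq P hb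
      rw [heq] at h
      exact ⟨s, hs, heq.ge, forall₂_and.1 h⟩
    · push Not at hm
      exact ⟨0, zero_le, le_maximinScore_iff.2 fun d hd => (hd (hm d)).elim, by simp [hm]⟩
  · rintro ⟨s, -, hy, hle, hlt⟩ b hb
    exact ⟨(hle b hb).trans hy, fun h => (hlt b hb h).trans_le hy⟩

end Maximin

/-! ### Manipulation by a single voter -/

section Manipulation

variable {m n : ℕ} {P : Profile m n} {j : Fin n}

/-- The number of voters other than `j` who prefer `a` to `b`. -/
def numOthersPrefer (P : Profile m n) (j : Fin n) (a b : Fin m) : ℕ :=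
  ((Finset.univ.erase j).filter fun i => (P i).Prefers a b).card

theorem numPrefer_update (v : Vote m) (a b : Fin m) :
    numPrefer (update P j v) a b =
      numOthersPrefer P j a b + if v.Prefers a b then 1 else 0 := by
  have others_eq : ∀ i ∈ Finset.univ.erase j,
      (if (update P j v i).Prefers a b then 1 else 0) = if (P i).Prefers a b then 1 else 0 :=
    fun i hi => by rw [Function.update_of_ne (Finset.ne_of_mem_erase hi)]
  rw [numPrefer, numOthersPrefer, Finset.card_filter, Finset.card_filter,
    ← Finset.sum_erase_add _ _ (Finset.mem_univ j), Finset.sum_congr rfl others_eq,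
    Function.update_self]

theorem replaceVotes_singleton (v : Vote m) :
    replaceVotes P {j} (fun _ => v) = update P j v := by
  funext i
  simp only [replaceVotes, Finset.mem_singleton, update_apply, dite_eq_ite]

theorem isCoalitionAgainst_singleton {r : Profile m n → Fin m} {y : Fin m} :
    IsCoalitionAgainst r P {j} y ↔
      y ≠ r P ∧ ∃ v : Vote m, v.Prefers (r P) y ∧ r (update P j v) = y := by
  refine and_congr_right fun _ => ⟨fun ⟨Q, hQ, hwin⟩ => ?_, fun ⟨v, hv, hwin⟩ => ?_⟩
  · have hQ' : Q = fun _ => Q ⟨j, Finset.mem_singleton_self j⟩ :=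
      funext fun i => congrArg Q (Subsingleton.elim _ _)
    rw [hQ', replaceVotes_singleton] at hwin
    exact ⟨_, hQ _, hwin⟩
  · exact ⟨fun _ => v, fun _ => hv, by rwa [replaceVotes_singleton]⟩

theorem not_isCoalitionAgainst_empty {r : Profile m n → Fin m} {y : Fin m} :
    ¬IsCoalitionAgainst r P ∅ y := by
  rintro ⟨hy, Q, -, hwin⟩
  exact hy (hwin.symm.trans (congrArg r (funext fun i => dif_neg (Finset.notMem_empty i))))

theorem exists_isCoalitionAgainst_iff {r : Profile m n → Fin m} {y : Fin m} :
    (∃ M : Finset (Fin n), M.card ≤ 1 ∧ IsCoalitionAgainst r P M y) ↔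
      ∃ j, IsCoalitionAgainst r P {j} y := by
  constructor
  · rintro ⟨M, hcard, hM⟩
    obtain rfl | ⟨j, hj⟩ := M.eq_empty_or_nonempty
    · exact (not_isCoalitionAgainst_empty hM).elim
    · obtain rfl := Finset.eq_singleton_iff_unique_mem.2
        ⟨hj, fun i hi => Finset.card_le_one.1 hcard i hi j hj⟩
      exact ⟨j, hM⟩
  · rintro ⟨j, hj⟩
    exact ⟨{j}, (Finset.card_singleton j).le, hj⟩

theorem exists_vote_of_lt {α : Type*} [LinearOrder α] (f : Fin m → α) :
    ∃ v : Vote m, ∀ a b, f a < f b → v.Prefers a b := by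
  refine ⟨Tuple.sort f, fun a b hab => not_le.1 fun hle => hab.not_ge ?_⟩
  simpa only [Function.comp_apply, Equiv.apply_symm_apply] using Tuple.monotone_sort f hle

theorem subset_iterate_of_vote {F : Set (Fin m) → Set (Fin m)} (hF : Monotone F) {v : Vote m}
    (hv : ∀ a, a ∈ F {b | v.Prefers b a}) (k : ℕ) : {a | (v.symm a : ℕ) < k} ⊆ F^[k] ∅ := by
  induction k with
  | zero => simp only [Nat.not_lt_zero, Set.ofPred_false, Set.empty_subset]
  | succ k ih =>
    rw [Function.iterate_succ_apply']
    exact fun a ha => hF (fun b hb => ih (lt_of_lt_of_le hb (Nat.lt_succ_iff.1 ha))) (hv a)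

theorem exists_vote_of_mem_iterate {F : Set (Fin m) → Set (Fin m)} (hF : Monotone F)
    (h : ∀ a, ∃ k, a ∈ F^[k] ∅) : ∃ v : Vote m, ∀ a, a ∈ F {b | v.Prefers b a} := by
  classical
  obtain ⟨v, hv⟩ := exists_vote_of_lt fun a => Nat.find (h a)
  refine ⟨v, fun a => ?_⟩
  obtain ⟨k, hk⟩ := Nat.exists_eq_succ_of_ne_zero
    (fun h0 : Nat.find (h a) = 0 => by simpa [h0] using Nat.find_spec (h a))
  have ha := Nat.find_spec (h a)
  rw [hk, Function.iterate_succ_apply'] at ha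
  exact hF (fun b hb => hv b a (hk ▸ Nat.lt_succ_of_le (Nat.find_min' (h b) hb))) ha

/-- A vote that places every candidate subject to a requirement on the set of candidates above it,
which only gets weaker as that set grows, can be found greedily from the top. -/
theorem exists_vote_forall_mem_iff {F : Set (Fin m) → Set (Fin m)} (hF : Monotone F) :
    (∃ v : Vote m, ∀ a, a ∈ F {b | v.Prefers b a}) ↔ ∀ a, a ∈ F^[m] ∅ :=
  ⟨fun ⟨_, hv⟩ _ => subset_iterate_of_vote hF hv m (Fin.is_lt _),
    fun h => exists_vote_of_mem_iterate hF fun _ => ⟨m, h _⟩⟩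

open Classical in
/-- The candidates that a manipulator against `y` may put directly below the set `T`, when the
winner is `x`, the other voters prefer `a` to `b` exactly `N a b` times, and `s` is the threshold
of `winner_maximin_eq_iff` for the victory of `y`. -/
def placeable (t : Vote m) (N : Fin m → Fin m → ℕ) (x y : Fin m) (s : ℕ) (T : Set (Fin m)) :
    Set (Fin m) :=
  {a | if a = y then x ∈ T else
    s ≤ N y a + (if y ∈ T then 1 else 0) ∧
      ∃ b ≠ a, N a b + (if b ∈ T then 0 else 1) < s + if t.Prefers y a then 1 else 0}

theorem monotone_placeable (t : Vote m) (N : Fin m → Fin m → ℕ) (x y : Fin m) (s : ℕ) :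
    Monotone (placeable t N x y s) := by
  intro T T' hT a ha
  have hT' : ∀ b, b ∈ T → b ∈ T' := fun b => @hT b
  simp only [placeable, Set.mem_ofPred_eq] at ha ⊢
  grind

theorem forall_mem_placeable_iff {t : Vote m} {x y : Fin m} {s : ℕ} {v : Vote m} :
    (∀ a, a ∈ placeable t (numOthersPrefer P j) x y s {b | v.Prefers b a}) ↔
      v.Prefers x y ∧ ∀ b ≠ y, s ≤ numPrefer (update P j v) y b ∧
        ∃ c ≠ b, numPrefer (update P j v) b c < s + if t.Prefers y b then 1 else 0 := by
  have mem_iff (b : Fin m) (hb : b ≠ y) :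
      b ∈ placeable t (numOthersPrefer P j) x y s {c | v.Prefers c b} ↔
        s ≤ numPrefer (update P j v) y b ∧
          ∃ c ≠ b, numPrefer (update P j v) b c < s + if t.Prefers y b then 1 else 0 := by
    simp only [placeable, Set.mem_ofPred_eq, if_neg hb, numPrefer_update]
    refine and_congr (by grind) (exists_congr fun c => and_congr_right fun hc => ?_)
    have := v.prefers_or_prefers hc
    have := @Vote.Prefers.not_prefers m v b c
    grind
  have mem_iff_self : y ∈ placeable t (numOthersPrefer P j) x y s {c | v.Prefers c y} ↔
      v.Prefers x y := by
    simp only [placeable, Set.mem_ofPred_eq, if_true]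
  constructor
  · exact fun h => ⟨mem_iff_self.1 (h y), fun b hb => (mem_iff b hb).1 (h b)⟩
  · rintro ⟨hxy, h⟩ a
    obtain rfl | ha := eq_or_ne a y
    exacts [mem_iff_self.2 hxy, (mem_iff a ha).2 (h a ha)]

theorem isCoalitionAgainst_singleton_iff [NeZero m] [NeZero n] {t : Vote m} {y : Fin m} :
    IsCoalitionAgainst (winner maximin t) P {j} y ↔ ∃ x ≠ y, winner maximin t P = x ∧
      ∃ s ≤ n, ∀ a, a ∈ (placeable t (numOthersPrefer P j) x y s)^[m] ∅ := by
  simp only [isCoalitionAgainst_singleton, winner_maximin_eq_iff (P := update P j _),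
    ← exists_vote_forall_mem_iff (monotone_placeable ..), forall_mem_placeable_iff]
  constructor
  · rintro ⟨hy, v, hv, s, hs, hwin⟩
    exact ⟨_, hy.symm, rfl, s, hs, v, hv, hwin⟩
  · rintro ⟨_, hy, rfl, s, hs, v, hv, hwin⟩
    exact ⟨hy.symm, v, hv, s, hs, hwin⟩

end Manipulation

/-! ### The algorithm -/

section Algorithm

/-- The number of candidates of the election whose code is a prefix of `l`. -/
def numCandidates (l : List ℕ) : ℕ := l.getD 0 0

/-- The number of voters of the election whose code is a prefix of `l`. -/
def numVoters (l : List ℕ) : ℕ := l.getD 1 0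

/-- The candidate at position `p` of the ballot `i` in an input `l`. The ballot `0` is the
tie-breaking order, and the ballot `i + 1` is the vote of the voter `i`. -/
def ballotEntry (l : List ℕ) (i p : ℕ) : ℕ := l.getD (2 + (i * numCandidates l + p)) 0

/-- The number of entries that the code of an election occupies in an input `l`. -/
def codeLength (l : List ℕ) : ℕ := 2 + (numVoters l + 1) * numCandidates l

/-- The entry with index `i` behind the code of the election in an input `l`. -/
def param (l : List ℕ) (i : ℕ) : ℕ := l.getD (codeLength l + i) 0

/-- The test whether a list of numbers starts with the code of an election. -/
def ElectionTest (l : List ℕ) : Prop :=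
  0 < numCandidates l ∧ 0 < numVoters l ∧ codeLength l ≤ l.length ∧
    ∀ i < numVoters l + 1, ∀ p < numCandidates l, ballotEntry l i p < numCandidates l ∧
      ∀ q < p, ballotEntry l i q ≠ ballotEntry l i p

/-- The test whether the ballot `i` in an input `l` ranks `a` before `b`. -/
def PrefersTest (l : List ℕ) (i a b : ℕ) : Prop :=
  ∃ p < numCandidates l, ∃ q < p, ballotEntry l i q = a ∧ ballotEntry l i p = b

open Classical in
/-- The number of voters other than `j` who prefer `a` to `b`. All voters are counted when `j` is
the number of voters. -/
noncomputable def countOthersPrefer (l : List ℕ) (j a b : ℕ) : ℕ :=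
  Nat.count (fun i => i ≠ j ∧ PrefersTest l (i + 1) a b) (numVoters l)

open Classical in
/-- The number that `winner_maximin_eq_iff` adds to the threshold `s` for the opponent `b`
of `y`. -/
noncomputable def tieBonus (l : List ℕ) (y b : ℕ) : ℕ := if PrefersTest l 0 y b then 1 else 0

/-- The test for the winner that is based on `winner_maximin_eq_iff`. -/
def WinnerTest (l : List ℕ) (y : ℕ) : Prop :=
  ∃ s < numVoters l + 1, ∀ b < numCandidates l, b = y ∨
    s ≤ countOthersPrefer l (numVoters l) y b ∧
      ∃ c < numCandidates l, c ≠ b ∧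
        countOthersPrefer l (numVoters l) b c < s + tieBonus l y b

open Classical in
/-- The test for membership in `placeable`. The set of candidates is given by the table `T` of its
indicator function. -/
def PlaceableTest (l : List ℕ) (j x y s : ℕ) (T : List Bool) (a : ℕ) : Prop :=
  if a = y then T.getD x false = true else
    s ≤ countOthersPrefer l j y a + (if T.getD y false = true then 1 else 0) ∧
      ∃ b < numCandidates l, b ≠ a ∧
        countOthersPrefer l j a b + (if T.getD b false = true then 0 else 1) <
          s + tieBonus l y a

open Classical in
/-- The table of the set in `isCoalitionAgainst_singleton_iff`. -/
noncomputable def placeableTable (l : List ℕ) (j x y s : ℕ) : List Bool :=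
  (fun T => (List.range (numCandidates l)).map fun a => decide (PlaceableTest l j x y s T a))^[
    numCandidates l] []

/-- The test for manipulation by the voter `j` against `y` that is based on
`isCoalitionAgainst_singleton_iff`. -/
def ManipulatorTest (l : List ℕ) (j y : ℕ) : Prop :=
  ∃ x < numCandidates l, x ≠ y ∧ WinnerTest l x ∧ ∃ s < numVoters l + 1,
    ∀ a < numCandidates l, (placeableTable l j x y s).getD a false = true

variable {α : Type} [StackEncodable α] {l : α → List ℕ} {i j p x y a b s : α → ℕ}
  {T : α → List Bool}

@[fun_prop]
theorem polyTime_numCandidates (hl : PolyTime l) : PolyTime fun c => numCandidates (l c) := by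
  unfold numCandidates
  fun_prop

@[fun_prop]
theorem polyTime_numVoters (hl : PolyTime l) : PolyTime fun c => numVoters (l c) := by
  unfold numVoters
  fun_prop

@[fun_prop]
theorem polyTime_ballotEntry (hl : PolyTime l) (hi : PolyTime i) (hp : PolyTime p) :
    PolyTime fun c => ballotEntry (l c) (i c) (p c) := by
  unfold ballotEntry
  fun_prop

@[fun_prop]
theorem polyTime_codeLength (hl : PolyTime l) : PolyTime fun c => codeLength (l c) := by
  unfold codeLength
  fun_prop

@[fun_prop]
theorem polyTime_param (hl : PolyTime l) (hi : PolyTime i) :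
    PolyTime fun c => param (l c) (i c) := by
  unfold param
  fun_prop

@[fun_prop]
theorem polyTime_electionTest (hl : PolyTime l) : PolyTime fun c => ElectionTest (l c) := by
  unfold ElectionTest
  fun_prop

@[fun_prop]
theorem polyTime_prefersTest (hl : PolyTime l) (hi : PolyTime i) (ha : PolyTime a)
    (hb : PolyTime b) : PolyTime fun c => PrefersTest (l c) (i c) (a c) (b c) := by
  unfold PrefersTest
  fun_prop

@[fun_prop]
theorem polyTime_countOthersPrefer (hl : PolyTime l) (hj : PolyTime j) (ha : PolyTime a)
    (hb : PolyTime b) : PolyTime fun c => countOthersPrefer (l c) (j c) (a c) (b c) := by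
  unfold countOthersPrefer
  fun_prop

@[fun_prop]
theorem polyTime_tieBonus (hl : PolyTime l) (hy : PolyTime y) (hb : PolyTime b) :
    PolyTime fun c => tieBonus (l c) (y c) (b c) := by
  unfold tieBonus
  fun_prop

@[fun_prop]
theorem polyTime_winnerTest (hl : PolyTime l) (hy : PolyTime y) :
    PolyTime fun c => WinnerTest (l c) (y c) := by
  unfold WinnerTest
  fun_prop

@[fun_prop]
theorem polyTime_placeableTest (hl : PolyTime l) (hj : PolyTime j) (hx : PolyTime x)
    (hy : PolyTime y) (hs : PolyTime s) (hT : PolyTime T) (ha : PolyTime a) :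
    PolyTime fun c => PlaceableTest (l c) (j c) (x c) (y c) (s c) (T c) (a c) := by
  unfold PlaceableTest
  fun_prop

@[fun_prop]
theorem polyTime_placeableTable (hl : PolyTime l) (hj : PolyTime j) (hx : PolyTime x)
    (hy : PolyTime y) (hs : PolyTime s) :
    PolyTime fun c => placeableTable (l c) (j c) (x c) (y c) (s c) := by
  classical
  have hm := polyTime_numCandidates hl
  refine .iterate hm (.const []) (.table (by fun_prop) (by fun_prop)) hm.size_le fun c k _ => ?_
  cases k with
  | zero => simp
  | succ k => simp [Function.iterate_succ_apply']

@[fun_prop]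
theorem polyTime_manipulatorTest (hl : PolyTime l) (hj : PolyTime j) (hy : PolyTime y) :
    PolyTime fun c => ManipulatorTest (l c) (j c) (y c) := by
  unfold ManipulatorTest
  fun_prop

end Algorithm

section Index

variable {m n : ℕ} (i : Fin n) (p : Fin m)

theorem mul_add_lt_mul : (i * m + p : ℕ) < n * m := by
  simpa only [finProdFinEquiv_apply_val, mul_comm, add_comm] using (finProdFinEquiv (i, p)).is_lt

theorem divNat_mul_add (h : i * m + p < n * m) : (⟨i * m + p, h⟩ : Fin (n * m)).divNat = i :=
  Fin.ext <| by
    simp only [Fin.coe_divNat, Nat.mul_add_div p.pos, mul_comm, Nat.div_eq_of_lt p.is_lt, add_zero]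

theorem modNat_mul_add (h : i * m + p < n * m) : (⟨i * m + p, h⟩ : Fin (n * m)).modNat = p :=
  Fin.ext <| by rw [Fin.coe_modNat, Nat.mul_add_mod_self_right, Nat.mod_eq_of_lt p.is_lt]

end Index

/-! ### Correctness of the algorithm -/

namespace Election

variable (E : Election) (s : List ℕ)

/-- The tie-breaking order followed by the votes, as in the code of `E`. -/
def ballots : Fin (E.n + 1) → Vote E.m := Fin.cons E.tie E.votes

theorem code_eq : E.code =
    E.m :: E.n :: List.ofFn fun k : Fin ((E.n + 1) * E.m) =>
      (E.ballots k.divNat k.modNat : ℕ) := by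
  simp only [List.ofFn_mul, divNat_mul_add, modNat_mul_add, List.ofFn_succ (n := E.n),
    List.flatten_cons]
  rfl

theorem length_code : E.code.length = 2 + (E.n + 1) * E.m := by
  rw [code_eq, List.length_cons, List.length_cons, List.length_ofFn]
  omega

theorem numCandidates_code_append : numCandidates (E.code ++ s) = E.m := rfl

theorem numVoters_code_append : numVoters (E.code ++ s) = E.n := rfl

theorem codeLength_code_append : codeLength (E.code ++ s) = E.code.length := E.length_code.symm

theorem ballotEntry_code_append (i : Fin (E.n + 1)) (p : Fin E.m) :
    ballotEntry (E.code ++ s) i p = E.ballots i p := by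
  have h := mul_add_lt_mul i p
  rw [ballotEntry, numCandidates_code_append, code_eq, List.cons_append, List.cons_append,
    add_comm 2, List.getD_cons_succ, List.getD_cons_succ,
    List.getD_append _ _ _ _ (by rwa [List.length_ofFn]),
    List.getD_eq_getElem _ _ (by rwa [List.length_ofFn]), List.getElem_ofFn, divNat_mul_add,
    modNat_mul_add]

theorem param_code_append (i : ℕ) : param (E.code ++ s) i = s.getD i 0 := by
  rw [param, codeLength_code_append, List.getD_append_right _ _ _ _ (Nat.le_add_right _ _),
    Nat.add_sub_cancel_left]

theorem electionTest_code_append : ElectionTest (E.code ++ s) := by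
  refine ⟨Nat.pos_of_neZero E.m, Nat.pos_of_neZero E.n, ?_, fun i hi p hp => ?_⟩
  · rw [codeLength_code_append, List.length_append]
    exact Nat.le_add_right _ _
  · have entry_eq := E.ballotEntry_code_append s ⟨i, hi⟩
    refine ⟨(entry_eq ⟨p, hp⟩).trans_lt (Fin.is_lt _), fun q hq h => hq.ne ?_⟩
    rw [entry_eq ⟨p, hp⟩, entry_eq ⟨q, hq.trans hp⟩] at h
    exact Fin.ext_iff.1 ((E.ballots _).injective (Fin.ext h))

end Election

theorem exists_vote_forall_eq {m : ℕ} {f : ℕ → ℕ} (hlt : ∀ p < m, f p < m)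
    (hne : ∀ p < m, ∀ q < p, f q ≠ f p) : ∃ v : Vote m, ∀ p : Fin m, (v p : ℕ) = f p := by
  let g (p : Fin m) : Fin m := ⟨f p, hlt p p.is_lt⟩
  have injective_g : g.Injective := .of_lt_imp_ne fun q p hqp h =>
    hne p p.is_lt q hqp (Fin.ext_iff.1 h)
  exact ⟨.ofBijective g (Finite.injective_iff_bijective.1 injective_g), fun _ => rfl⟩

theorem exists_code_append_eq {m n : ℕ} [NeZero m] [NeZero n] {r : List ℕ}
    (hlen : (n + 1) * m ≤ r.length) (ballot : Fin (n + 1) → Vote m)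
    (h : ∀ i p, (ballot i p : ℕ) = r.getD (i * m + p) 0) :
    ∃ (E : Election) (s : List ℕ), E.code ++ s = m :: n :: r := by
  let E : Election := ⟨m, n, ballot 0, Fin.tail ballot⟩
  have ballots_eq : E.ballots = ballot := Fin.cons_self_tail ballot
  have take_eq : r.take ((n + 1) * m) =
      List.ofFn fun k : Fin ((n + 1) * m) => (ballot k.divNat k.modNat : ℕ) := by
    refine List.ext_getElem (by simpa using hlen) fun k h1 _ => ?_
    rw [List.getElem_ofFn, h, Fin.coe_divNat, Fin.coe_modNat, Nat.div_add_mod', List.getElem_take,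
      List.getD_eq_getElem]
  refine ⟨E, r.drop ((n + 1) * m), ?_⟩
  rw [E.code_eq, ballots_eq, List.cons_append, List.cons_append, ← take_eq, List.take_append_drop]

theorem electionTest_iff {l : List ℕ} :
    ElectionTest l ↔ ∃ (E : Election) (s : List ℕ), E.code ++ s = l := by
  refine ⟨fun ⟨hm, hn, hlen, hballot⟩ => ?_, fun ⟨E, s, h⟩ => h ▸ E.electionTest_code_append s⟩
  obtain ⟨m, n, r, rfl⟩ : ∃ m n r, l = m :: n :: r := by
    obtain _ | ⟨m, _ | ⟨n, r⟩⟩ := l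
    · grind [codeLength]
    · grind [codeLength]
    · exact ⟨m, n, r, rfl⟩
  have ballotEntry_eq i p : ballotEntry (m :: n :: r) i p = r.getD (i * m + p) 0 := by
    rw [ballotEntry, add_comm 2]
    rfl
  simp only [numCandidates, numVoters, codeLength, ballotEntry_eq, List.getD_cons_zero,
    List.getD_cons_succ, List.length_cons] at hm hn hlen hballot
  have : NeZero m := ⟨hm.ne'⟩
  have : NeZero n := ⟨hn.ne'⟩
  choose ballot hballot_eq using fun i : Fin (n + 1) =>
    exists_vote_forall_eq (fun p hp => (hballot i i.is_lt p hp).1)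
      (fun p hp => (hballot i i.is_lt p hp).2)
  exact exists_code_append_eq (by omega) ballot hballot_eq

theorem card_filter_univ_eq_count {p : ℕ → Prop} [DecidablePred p] (n : ℕ) :
    (Finset.univ.filter fun i : Fin n => p i).card = Nat.count p n := by
  rw [Nat.count_eq_card_filter_range, Finset.card_filter, Finset.card_filter,
    Fin.sum_univ_eq_sum_range (fun i => if p i then 1 else 0)]

namespace Election

variable {E : Election} (s : List ℕ)

theorem forall_lt_numCandidates_iff {p : ℕ → Prop} :
    (∀ a < numCandidates (E.code ++ s), p a) ↔ ∀ a : Fin E.m, p a := by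
  rw [numCandidates_code_append, Fin.forall_iff]

theorem exists_lt_numCandidates_iff {p : ℕ → Prop} :
    (∃ a < numCandidates (E.code ++ s), p a) ↔ ∃ a : Fin E.m, p a := by
  simp only [Fin.exists_iff, exists_prop, numCandidates_code_append]

theorem prefersTest_code_append (i : Fin (E.n + 1)) (a b : Fin E.m) :
    PrefersTest (E.code ++ s) i a b ↔ (E.ballots i).Prefers a b := by
  have entry_eq_iff (p : Fin E.m) (a : Fin E.m) :
      ballotEntry (E.code ++ s) i p = a ↔ p = (E.ballots i).symm a := by
    rw [ballotEntry_code_append, Fin.val_inj, Equiv.eq_symm_apply]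
  have exists_lt_iff (p : Fin E.m) : (∃ q < (p : ℕ), ballotEntry (E.code ++ s) i q = a) ↔
      (E.ballots i).symm a < p := by
    constructor
    · rintro ⟨q, hq, h⟩
      exact (entry_eq_iff ⟨q, hq.trans p.is_lt⟩ a).1 h ▸ hq
    · exact fun h => ⟨_, h, (entry_eq_iff _ a).2 rfl⟩
  rw [PrefersTest, exists_lt_numCandidates_iff]
  simp only [← and_assoc, exists_and_right, entry_eq_iff, exists_lt_iff, exists_eq_right,
    Vote.Prefers]

theorem prefersTest_succ_code_append (i : Fin E.n) (a b : Fin E.m) :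
    PrefersTest (E.code ++ s) (i + 1) a b ↔ (E.votes i).Prefers a b :=
  prefersTest_code_append s i.succ a b

theorem countOthersPrefer_code_append (j : Fin E.n) (a b : Fin E.m) :
    countOthersPrefer (E.code ++ s) j a b = numOthersPrefer E.votes j a b := by
  classical
  rw [countOthersPrefer, numVoters_code_append, ← card_filter_univ_eq_count, numOthersPrefer]
  simp only [prefersTest_succ_code_append, ne_eq, Fin.val_inj, ← Finset.filter_filter,
    Finset.filter_ne']

theorem countOthersPrefer_n_code_append (a b : Fin E.m) :
    countOthersPrefer (E.code ++ s) E.n a b = numPrefer E.votes a b := by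
  classical
  rw [countOthersPrefer, numVoters_code_append, ← card_filter_univ_eq_count, numPrefer]
  simp only [prefersTest_succ_code_append, ne_eq, (Fin.is_lt _).ne, not_false_eq_true, true_and]

theorem tieBonus_code_append (y b : Fin E.m) :
    tieBonus (E.code ++ s) y b = if E.tie.Prefers y b then 1 else 0 := by
  classical exact if_congr (prefersTest_code_append s 0 y b) rfl rfl

theorem winnerTest_code_append (y : Fin E.m) :
    WinnerTest (E.code ++ s) y ↔ E.winner maximin E.votes = y := by
  simp only [WinnerTest, winner, winner_maximin_eq_iff, forall_lt_numCandidates_iff,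
    exists_lt_numCandidates_iff, countOthersPrefer_n_code_append, tieBonus_code_append, ne_eq,
    Fin.val_inj, or_iff_not_imp_left, Nat.lt_succ_iff, numVoters_code_append]

theorem placeableTest_code_append (j : Fin E.n) (x y a : Fin E.m) (k : ℕ) {T : List Bool}
    {S : Set (Fin E.m)} (hT : ∀ b : Fin E.m, T.getD b false = true ↔ b ∈ S) :
    PlaceableTest (E.code ++ s) j x y k T a ↔
      a ∈ placeable E.tie (numOthersPrefer E.votes j) x y k S := by
  classical
  simp only [PlaceableTest, placeable, hT, Fin.val_inj, exists_lt_numCandidates_iff,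
    countOthersPrefer_code_append, tieBonus_code_append, ne_eq, Set.mem_ofPred_eq]

theorem getD_placeableTable_code_append (j : Fin E.n) (x y a : Fin E.m) (k : ℕ) :
    (placeableTable (E.code ++ s) j x y k).getD a false = true ↔
      a ∈ (placeable E.tie (numOthersPrefer E.votes j) x y k)^[E.m] ∅ := by
  classical
  rw [placeableTable]
  suffices ∀ i, (_^[i] []).getD a false = true ↔ a ∈ _^[i] ∅ from this E.m
  intro i
  induction i generalizing a with
  | zero => simp only [Function.iterate_zero, id, List.getD_nil, Set.mem_empty_iff_false,
      Bool.false_eq_true]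
  | succ i ih =>
    have ha : a < numCandidates (E.code ++ s) := a.is_lt
    rw [Function.iterate_succ_apply', Function.iterate_succ_apply',
      ← placeableTest_code_append s j x y a k ih, List.getD_eq_getElem _ _
        (by rwa [List.length_map, List.length_range]),
      List.getElem_map, List.getElem_range, decide_eq_true_iff]

theorem manipulatorTest_code_append (j : Fin E.n) (y : Fin E.m) :
    ManipulatorTest (E.code ++ s) j y ↔
      IsCoalitionAgainst (E.winner maximin) E.votes {j} y := by
  refine Iff.trans ?_ isCoalitionAgainst_singleton_iff.symm
  simp only [ManipulatorTest, exists_lt_numCandidates_iff, forall_lt_numCandidates_iff,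
    winnerTest_code_append, getD_placeableTable_code_append, numVoters_code_append, ne_eq,
    Fin.val_inj, Nat.lt_succ_iff, Election.winner]

end Election

/-! ### Membership in P -/

section Lists

variable {n y : ℕ} {s u : List ℕ} {i : ℕ} {j : Fin n}

theorem eq_iff_getD : s = u ↔ s.length = u.length ∧ ∀ i < u.length, s.getD i 0 = u.getD i 0 := by
  refine ⟨fun h => h ▸ ⟨rfl, fun _ _ => rfl⟩, fun ⟨hlen, h⟩ => List.ext_getElem hlen ?_⟩
  intro i hs hu
  rw [← List.getD_eq_getElem s 0 hs, ← List.getD_eq_getElem u 0 hu, h i hu]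

theorem eq_append_singleton_iff_getD : s = u ++ [y] ↔
    s.length = u.length + 1 ∧ (∀ i < u.length, s.getD i 0 = u.getD i 0) ∧
      s.getD u.length 0 = y := by
  rw [eq_iff_getD, List.length_append, List.length_singleton]
  refine and_congr_right fun _ => Nat.forall_lt_succ_right.trans (and_congr ?_ ?_)
  · exact forall₂_congr fun i hi => by rw [List.getD_append _ _ _ _ hi]
  · rw [List.getD_append_right _ _ _ _ le_rfl, Nat.sub_self, List.getD_cons_zero]

theorem length_coalitionCode {M : Finset (Fin n)} : (coalitionCode M).length = n :=
  List.length_ofFn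

theorem getD_coalitionCode_singleton (hi : i < n) :
    (coalitionCode {j}).getD i 0 = if i = j then 1 else 0 := by
  rw [List.getD_eq_getElem _ _ (length_coalitionCode.symm ▸ hi)]
  simp only [coalitionCode, List.getElem_ofFn, Finset.mem_singleton, Fin.ext_iff]

end Lists

section Problems

/-- The test whether the parameters in an input `l` start with `coalitionCode {j}`. -/
def CoalitionTest (l : List ℕ) (j : ℕ) : Prop :=
  ∀ i < numVoters l, param l i = if i = j then 1 else 0

/-- The algorithm for CPMW with a single manipulator. -/
def CPMWTest (l : List ℕ) : Prop :=
  ∃ j < numVoters l, ∃ y < numCandidates l, l.length = codeLength l + (numVoters l + 1) ∧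
    CoalitionTest l j ∧ param l (numVoters l) = y ∧ ManipulatorTest l j y

/-- The algorithm for CPM with a single manipulator. -/
def CPMTest (l : List ℕ) : Prop :=
  ∃ j < numVoters l, ∃ y < numCandidates l, l.length = codeLength l + numVoters l ∧
    CoalitionTest l j ∧ ManipulatorTest l j y

/-- The algorithm for CPMSW with a single manipulator. -/
def CPMSWTest (l : List ℕ) : Prop :=
  ∃ j < numVoters l, ∃ y < numCandidates l, l.length = codeLength l + 2 ∧
    param l 0 = y ∧ param l 1 = 1 ∧ ManipulatorTest l j y

/-- The algorithm for CPMS with a single manipulator. -/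
def CPMSTest (l : List ℕ) : Prop :=
  ∃ j < numVoters l, ∃ y < numCandidates l, l.length = codeLength l + 1 ∧
    param l 0 = 1 ∧ ManipulatorTest l j y

theorem polyTime_cpmwTest : PolyTime CPMWTest := by
  unfold CPMWTest CoalitionTest
  fun_prop

theorem polyTime_cpmTest : PolyTime CPMTest := by
  unfold CPMTest CoalitionTest
  fun_prop

theorem polyTime_cpmswTest : PolyTime CPMSWTest := by
  unfold CPMSWTest
  fun_prop

theorem polyTime_cpmsTest : PolyTime CPMSTest := by
  unfold CPMSTest
  fun_prop

variable {E : Election} {s : List ℕ}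

theorem length_code_append_eq_iff {k : ℕ} :
    (E.code ++ s).length = codeLength (E.code ++ s) + k ↔ s.length = k := by
  rw [E.codeLength_code_append, List.length_append, Nat.add_left_cancel_iff]

theorem exists_lt_numVoters_iff {p : ℕ → Prop} :
    (∃ j < numVoters (E.code ++ s), p j) ↔ ∃ j : Fin E.n, p j := by
  simp only [Fin.exists_iff, exists_prop, E.numVoters_code_append]

theorem cpmwTest_code_append : CPMWTest (E.code ++ s) ↔
    ∃ (j : Fin E.n) (y : Fin E.m), s = coalitionCode {j} ++ [(y : ℕ)] ∧
      IsCoalitionAgainst (E.winner maximin) E.votes {j} y := by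
  rw [CPMWTest, exists_lt_numVoters_iff]
  simp only [CoalitionTest, E.exists_lt_numCandidates_iff, length_code_append_eq_iff,
    E.manipulatorTest_code_append, E.numVoters_code_append, E.param_code_append,
    eq_append_singleton_iff_getD, length_coalitionCode, and_assoc]
  simp +contextual only [getD_coalitionCode_singleton]

theorem cpmTest_code_append : CPMTest (E.code ++ s) ↔
    ∃ (j : Fin E.n) (y : Fin E.m), s = coalitionCode {j} ∧
      IsCoalitionAgainst (E.winner maximin) E.votes {j} y := by
  rw [CPMTest, exists_lt_numVoters_iff]
  simp only [CoalitionTest, E.exists_lt_numCandidates_iff, length_code_append_eq_iff,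
    E.manipulatorTest_code_append, E.numVoters_code_append, E.param_code_append,
    eq_iff_getD (u := coalitionCode _), length_coalitionCode, and_assoc]
  simp +contextual only [getD_coalitionCode_singleton]

theorem cpmswTest_code_append : CPMSWTest (E.code ++ s) ↔
    ∃ (j : Fin E.n) (y : Fin E.m), s = [(y : ℕ), 1] ∧
      IsCoalitionAgainst (E.winner maximin) E.votes {j} y := by
  simp only [CPMSWTest, exists_lt_numVoters_iff, E.exists_lt_numCandidates_iff,
    length_code_append_eq_iff, E.manipulatorTest_code_append, E.param_code_append,
    eq_iff_getD (u := [_, _]), List.length_cons, List.length_nil, Nat.forall_lt_succ_right,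
    Nat.not_lt_zero, IsEmpty.forall_iff, implies_true, true_and, List.getD_cons_zero,
    List.getD_cons_succ, and_assoc, zero_add, Nat.reduceAdd]

theorem cpmsTest_code_append : CPMSTest (E.code ++ s) ↔
    ∃ (j : Fin E.n) (y : Fin E.m), s = [1] ∧
      IsCoalitionAgainst (E.winner maximin) E.votes {j} y := by
  simp only [CPMSTest, exists_lt_numVoters_iff, E.exists_lt_numCandidates_iff,
    length_code_append_eq_iff, E.manipulatorTest_code_append, E.param_code_append,
    eq_iff_getD (u := [_]), List.length_cons, List.length_nil, Nat.forall_lt_succ_right,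
    Nat.not_lt_zero, IsEmpty.forall_iff, implies_true, true_and, List.getD_cons_zero, and_assoc,
    zero_add]

theorem DecisionProblem.inP_of_polyTime {p : DecisionProblem} {D : List ℕ → Prop}
    (hD : PolyTime D)
    (h : ∀ w, w ∈ p.language ↔
      ∃ (E : Election) (s : List ℕ), D (E.code ++ s) ∧ encodeNats (E.code ++ s) = w) :
    p.InP := by
  have language_eq : p.language = {w | ∃ l, (ElectionTest l ∧ D l) ∧ encodeNats l = w} := by
    refine Set.ext fun w => (h w).trans ⟨?_, ?_⟩
    · exact fun ⟨E, s, hs, hw⟩ => ⟨_, ⟨E.electionTest_code_append s, hs⟩, hw⟩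
    · rintro ⟨l, ⟨hl, hD⟩, hw⟩
      obtain ⟨E, s, rfl⟩ := electionTest_iff.1 hl
      exact ⟨E, s, hD, hw⟩
  rw [DecisionProblem.InP, language_eq]
  exact languageInP_encodeNats (by fun_prop)

theorem cpmw_maximin_inP :
    ((CPMW maximin).restrict fun I : CPMWInstance => I.M.card = 1).InP := by
  refine DecisionProblem.inP_of_polyTime polyTime_cpmwTest fun w => ?_
  simp only [cpmwTest_code_append]
  constructor
  · rintro ⟨⟨⟨E, M, y⟩, (hM : M.card = 1)⟩, hyes, rfl⟩
    obtain ⟨j, rfl⟩ := Finset.card_eq_one.1 hM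
    exact ⟨E, _, ⟨j, y, rfl, hyes⟩, rfl⟩
  · rintro ⟨E, _, ⟨j, y, rfl, hyes⟩, rfl⟩
    exact ⟨⟨⟨E, {j}, y⟩, Finset.card_singleton j⟩, hyes, rfl⟩

theorem cpm_maximin_inP :
    ((CPM maximin).restrict fun I : CPMInstance => I.M.card = 1).InP := by
  refine DecisionProblem.inP_of_polyTime polyTime_cpmTest fun w => ?_
  simp only [cpmTest_code_append]
  constructor
  · rintro ⟨⟨⟨E, M⟩, (hM : M.card = 1)⟩, ⟨y, hyes⟩, rfl⟩
    obtain ⟨j, rfl⟩ := Finset.card_eq_one.1 hM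
    exact ⟨E, _, ⟨j, y, rfl, hyes⟩, rfl⟩
  · rintro ⟨E, _, ⟨j, y, rfl, hyes⟩, rfl⟩
    exact ⟨⟨⟨E, {j}⟩, Finset.card_singleton j⟩, ⟨y, hyes⟩, rfl⟩

theorem cpmsw_maximin_inP :
    ((CPMSW maximin).restrict fun I : CPMSWInstance => I.k = 1).InP := by
  refine DecisionProblem.inP_of_polyTime polyTime_cpmswTest fun w => ?_
  simp only [cpmswTest_code_append]
  constructor
  · rintro ⟨⟨⟨E, y, k⟩, (hk : k = 1)⟩, hyes, rfl⟩
    subst hk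
    obtain ⟨j, hj⟩ := exists_isCoalitionAgainst_iff.1 hyes
    exact ⟨E, _, ⟨j, y, rfl, hj⟩, rfl⟩
  · rintro ⟨E, _, ⟨j, y, rfl, hj⟩, rfl⟩
    exact ⟨⟨⟨E, y, 1⟩, rfl⟩, exists_isCoalitionAgainst_iff.2 ⟨j, hj⟩, rfl⟩

theorem cpms_maximin_inP :
    ((CPMS maximin).restrict fun I : CPMSInstance => I.k = 1).InP := by
  refine DecisionProblem.inP_of_polyTime polyTime_cpmsTest fun w => ?_
  simp only [cpmsTest_code_append]
  constructor
  · rintro ⟨⟨⟨E, k⟩, (hk : k = 1)⟩, ⟨M, hM, y, hyes⟩, rfl⟩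
    subst hk
    obtain ⟨j, hj⟩ := exists_isCoalitionAgainst_iff.1 ⟨M, hM, hyes⟩
    exact ⟨E, _, ⟨j, y, rfl, hj⟩, rfl⟩
  · rintro ⟨E, _, ⟨j, y, rfl, hj⟩, rfl⟩
    obtain ⟨M, hM, hyes⟩ := exists_isCoalitionAgainst_iff.2 ⟨j, hj⟩
    exact ⟨⟨⟨E, 1⟩, rfl⟩, ⟨M, hM, y, hyes⟩, rfl⟩

end Problems

end PossibleManipulators

open PossibleManipulators in
theorem mainTheorem5 :
    ((CPMW maximin).restrict fun I : CPMWInstance => I.M.card = 1).InP ∧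
    ((CPM maximin).restrict fun I : CPMInstance => I.M.card = 1).InP ∧
    ((CPMSW maximin).restrict fun I : CPMSWInstance => I.k = 1).InP ∧
    ((CPMS maximin).restrict fun I : CPMSInstance => I.k = 1).InP :=
  ⟨cpmw_maximin_inP, cpm_maximin_inP, cpmsw_maximin_inP, cpms_maximin_inP⟩
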